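/- For $0<\gamma<\pi/2$ let $S_\gamma=\{z\in\mathbb C:\operatorname{Re} z>0,\ |\arg z|<\gamma\}$. Let $0<\beta<\alpha<\pi/2$, and let $\mu$ be a complex Borel measure carried by a compact subset of $S_\beta$ which is symmetric, i.e. $\mu(\overline S)=\overline{\mu(S)}$ for all Borel sets $S$ (where $\overline S$ is the set of complex conjugates of the points of $S$), and has $\int d\mu=0$. Let $F(z)=\int e^{-z\xi}\,d\mu(\xi)$, $z\in\mathbb C$, be its Fourier–Borel transform. Let $T=(T(t))_{t\in S_\alpha}$ be an analytic semigroup of bounded operators on a complex Banach space $X$, i.e. a norm-analytic map $T:S_\alpha\to\mathcal B(X)$ with $T(s+t)=T(s)T(t)$ for $s,t\in S_\alpha$ (no continuity at $0$ is required), and suppose that $T$ is not quasinilpotent, i.e. $\rho(T(t))\neq0$ for some $t\in S_\alpha$, where $\rho$ denotes the spectral radius. For $u\in S_{\alpha-\beta}$ put $F(-uA)=\int T(u\xi)\,d\mu(\xi)$ (a Bochner integral in $\mathcal B(X)$). Let $\mathcal A_T$ be the closed, not necessarily unital, subalgebra of $\mathcal B(X)$ generated by $\{T(t):t\in S_\alpha\}$,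 let $\operatorname{rad}\mathcal A_T$ be its Jacobson radical (the intersection of its maximal modular ideals), and let $\pi:\mathcal A_T\to\mathcal A_T/\operatorname{rad}\mathcal A_T$ be the canonical surjection. If there exists $t_0>0$ such that $$\sup_{t\in S_{\alpha-\beta},\ |t|\le t_0}\rho(F(-tA))<\sup_{z\in S_{\alpha-\beta}}|F(z)|,$$ then the Banach algebra $\mathcal A_T/\operatorname{rad}\mathcal A_T$ is unital (with nonzero identity), and the generator of the semigroup $(\pi(T(t)))$, acting by multiplication on $\mathcal A_T/\operatorname{rad}\mathcal A_T$, is bounded: the limit $\lim_{t\to0+}\bigl(\pi(T(t))y-y\bigr)/t$ exists for every $y\in\mathcal A_T/\operatorname{rad}\mathcal A_T$ and defines a bounded operator. -/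

import Mathlib

open Set Filter Topology MeasureTheory
open scoped ENNReal

noncomputable section

namespace SectorialSemigroup

/-! ### Sectors, complex measures, Fourier–Borel transforms -/

/-- The open sector `S_α = {z : Re z > 0, |arg z| < α}`. -/
def sector (α : ℝ) : Set ℂ := {z | 0 < z.re ∧ |z.arg| < α}

/-- `μ ∈ M_c(S)`: the complex Borel measure `μ` is carried by a compact subset of `S`
(its total variation vanishes off that compact set). -/
def IsCompactlySupportedIn (μ : ComplexMeasure ℂ) (S : Set ℂ) : Prop :=
  ∃ K : Set ℂ, IsCompact K ∧ K ⊆ S ∧ μ.variation Kᶜ = 0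

/-- `μ` is symmetric: the measure of the complex conjugate of `s` is the conjugate of `μ s`. -/
def IsSymmetricMeasure (μ : ComplexMeasure ℂ) : Prop :=
  ∀ s : Set ℂ, MeasurableSet s → μ (starRingEnd ℂ '' s) = starRingEnd ℂ (μ s)

/-- The integral `∫ f dμ` of a vector-valued function against a complex measure. -/
def cintegral {E : Type*} [NormedAddCommGroup E] [NormedSpace ℂ E]
    (μ : ComplexMeasure ℂ) (f : ℂ → E) : E :=
  μ.integral f (ContinuousLinearMap.lsmul ℝ ℂ : ℂ →L[ℝ] E →L[ℝ] E).flip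

/-- The Fourier–Borel transform `F(z) = ∫ e^{-zξ} dμ(ξ)`. -/
def fourierBorel (μ : ComplexMeasure ℂ) (z : ℂ) : ℂ :=
  cintegral μ fun ξ => Complex.exp (-(z * ξ))

/-! ### The radical of a commutative complex Banach algebra without assumed identity -/

section Radical

variable {A : Type*} [NonUnitalNormedCommRing A] [NormedSpace ℂ A]

/-- A linear subspace that is an (algebra) ideal. -/
def IsAlgIdeal (I : Submodule ℂ A) : Prop := ∀ a x : A, x ∈ I → a * x ∈ I

/-- A modular ideal: there is an identity modulo the ideal. -/
def IsModularIdeal (I : Submodule ℂ A) : Prop :=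
  IsAlgIdeal I ∧ ∃ e : A, ∀ x : A, x - e * x ∈ I

/-- A maximal modular ideal: a proper modular ideal that is maximal among the proper ideals. -/
def IsMaximalModularIdeal (I : Submodule ℂ A) : Prop :=
  IsModularIdeal I ∧ I ≠ ⊤ ∧ ∀ J : Submodule ℂ A, IsAlgIdeal J → I < J → J = ⊤

variable (A) in
/-- The (Jacobson) radical: the intersection of all maximal modular ideals; it is the whole
algebra if there are none. -/
def radical : Submodule ℂ A := sInf {I | IsMaximalModularIdeal I}

theorem radical_isAlgIdeal : IsAlgIdeal (radical A) := by
  intro a x hx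
  rw [radical, Submodule.mem_sInf] at hx ⊢
  exact fun I hI => hI.1.1 a x (hx I hI)

theorem exists_quasi_inverse {A : Type*} [NonUnitalNormedCommRing A] [CompleteSpace A] (y : A) (hy : ‖y‖ < 1) : ∃ z : A, z = y + y * z := by
  have hc : ContractingWith ‖y‖₊ (fun z : A => y + y * z) := by
    refine ⟨by exact_mod_cast hy, LipschitzWith.of_dist_le_mul fun u v => ?_⟩
    rw [dist_add_left, dist_eq_norm, dist_eq_norm, ← mul_sub]
    exact norm_mul_le _ _
  exact ⟨hc.fixedPoint, hc.fixedPoint_isFixedPt.symm⟩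

theorem IsMaximalModularIdeal.isClosed [CompleteSpace A] {I : Submodule ℂ A}
    (hI : IsMaximalModularIdeal I) : IsClosed (I : Set A) := by
  obtain ⟨⟨hid, e, he⟩, hne, hmax⟩ := hI
  by_contra hcl
  have hJ : IsAlgIdeal I.topologicalClosure := by
    intro a x hx
    have hx' : x ∈ closure (I : Set A) := hx
    exact map_mem_closure (continuous_const_mul a) hx' fun y hy => hid a y hy
  have hlt : I < I.topologicalClosure := by
    refine lt_of_le_of_ne I.le_topologicalClosure fun h => hcl ?_
    rw [h]
    exact I.isClosed_topologicalClosure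
  have hmem : e ∈ closure (I : Set A) := by
    have : e ∈ I.topologicalClosure := by rw [hmax _ hJ hlt]; trivial
    exact this
  obtain ⟨x, hx, hd⟩ := Metric.mem_closure_iff.1 hmem 1 one_pos
  rw [dist_eq_norm] at hd
  obtain ⟨z, hz⟩ := exists_quasi_inverse (e - x) hd
  have heI : e ∈ I := by
    have h1 : e = x + (z - e * z) + z * x := by
      rw [mul_comm z x]
      have h2 : z = (e - x) + (e * z - x * z) := by rw [← sub_mul]; exact hz
      have h3 : z - (e * z - x * z) = e - x := sub_eq_of_eq_add h2
      have h4 : x + (z - e * z) + x * z = x + (z - (e * z - x * z)) := by abel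
      rw [h4, h3]; abel
    rw [h1]
    exact I.add_mem (I.add_mem hx (he z)) (hid z x hx)
  refine hne (Submodule.eq_top_iff'.2 fun y => ?_)
  have h5 : y = (y - e * y) + y * e := by rw [mul_comm y e]; abel
  rw [h5]
  exact I.add_mem (he y) (hid y e heI)

instance radical_isClosed [CompleteSpace A] : IsClosed (radical A : Set A) := by
  rw [radical, Submodule.coe_sInf]
  exact isClosed_biInter fun I hI => IsMaximalModularIdeal.isClosed hI

variable (A) in
/-- The quotient Banach algebra `A / rad A`, with the quotient norm. -/
abbrev RadicalQuotient : Type _ := A ⧸ radical A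

/-- The canonical surjection `π : A → A / rad A`. -/
def toRadicalQuotient : A →ₗ[ℂ] RadicalQuotient A := (radical A).mkQ

instance : Mul (RadicalQuotient A) where
  mul := Quotient.map₂ (· * ·) <| by
    intro a a' ha b b' hb
    have ha' : a - a' ∈ radical A := (Submodule.quotientRel_def _).1 ha
    have hb' : b - b' ∈ radical A := (Submodule.quotientRel_def _).1 hb
    refine (Submodule.quotientRel_def _).2 ?_
    have h : a * b - a' * b' = b * (a - a') + a' * (b - b') := by
      rw [mul_sub, mul_sub, mul_comm b a, mul_comm b a']; abel
    rw [h]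
    exact (radical A).add_mem (radical_isAlgIdeal _ _ ha') (radical_isAlgIdeal _ _ hb')

theorem toRadicalQuotient_mul (a b : A) :
    toRadicalQuotient (a * b) = toRadicalQuotient a * toRadicalQuotient b := rfl

theorem toRadicalQuotient_surjective : Function.Surjective (toRadicalQuotient (A := A)) :=
  Submodule.mkQ_surjective _

instance [CompleteSpace A] : NonUnitalNormedCommRing (RadicalQuotient A) :=
  { (inferInstance : NormedAddCommGroup (RadicalQuotient A)),
    (inferInstance : Mul (RadicalQuotient A)) with
    left_distrib := by
      rintro ⟨a⟩ ⟨b⟩ ⟨c⟩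
      exact congrArg toRadicalQuotient (mul_add a b c)
    right_distrib := by
      rintro ⟨a⟩ ⟨b⟩ ⟨c⟩
      exact congrArg toRadicalQuotient (add_mul a b c)
    zero_mul := by
      rintro ⟨a⟩
      exact congrArg toRadicalQuotient (zero_mul a)
    mul_zero := by
      rintro ⟨a⟩
      exact congrArg toRadicalQuotient (mul_zero a)
    mul_assoc := by
      rintro ⟨a⟩ ⟨b⟩ ⟨c⟩
      exact congrArg toRadicalQuotient (mul_assoc a b c)
    mul_comm := by
      rintro ⟨a⟩ ⟨b⟩
      exact congrArg toRadicalQuotient (mul_comm a b)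
    norm_mul_le := by
      intro x y
      have hlim : Tendsto (fun ε : ℝ => (‖x‖ + ε) * (‖y‖ + ε)) (𝓝[>] 0) (𝓝 (‖x‖ * ‖y‖)) := by
        have hc : Continuous fun ε : ℝ => (‖x‖ + ε) * (‖y‖ + ε) := by fun_prop
        simpa using (hc.tendsto 0).mono_left nhdsWithin_le_nhds
      refine ge_of_tendsto hlim (eventually_nhdsWithin_of_forall fun ε hε => ?_)
      obtain ⟨a, ha, hna⟩ := Submodule.Quotient.norm_mk_lt x hε
      obtain ⟨b, hb, hnb⟩ := Submodule.Quotient.norm_mk_lt y hε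
      have hxy : x * y = Submodule.Quotient.mk (a * b) := by rw [← ha, ← hb]; rfl
      rw [hxy]
      exact (Submodule.Quotient.norm_mk_le _ _).trans <| (norm_mul_le a b).trans <|
        mul_le_mul hna.le hnb.le (norm_nonneg _) ((norm_nonneg _).trans hna.le) }

instance [CompleteSpace A] [IsScalarTower ℂ A A] :
    IsScalarTower ℂ (RadicalQuotient A) (RadicalQuotient A) where
  smul_assoc := by
    rintro c ⟨a⟩ ⟨b⟩
    exact congrArg toRadicalQuotient (smul_mul_assoc c a b)

instance [CompleteSpace A] [SMulCommClass ℂ A A] :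
    SMulCommClass ℂ (RadicalQuotient A) (RadicalQuotient A) where
  smul_comm := by
    rintro c ⟨a⟩ ⟨b⟩
    exact congrArg toRadicalQuotient (mul_smul_comm c a b).symm

/-- The algebra has a (nonzero) identity element. -/
def IsUnital (A : Type*) [NonUnitalNormedCommRing A] : Prop :=
  ∃ e : A, e ≠ 0 ∧ ∀ x : A, e * x = x ∧ x * e = x

end Radical

/-! ### Generators -/

section Generator

variable {Y : Type*} [NormedAddCommGroup Y] [NormedSpace ℂ Y]

/-- `(S(t) y - y) / t → z` as `t ↓ 0`. -/
def HasGeneratorValue (S : ℝ → Y →L[ℂ] Y) (y z : Y) : Prop :=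
  Tendsto (fun t : ℝ => ((t : ℂ)⁻¹) • (S t y - y)) (𝓝[>] 0) (𝓝 z)

theorem HasGeneratorValue.add {S : ℝ → Y →L[ℂ] Y} {y y' z z' : Y}
    (h : HasGeneratorValue S y z) (h' : HasGeneratorValue S y' z') :
    HasGeneratorValue S (y + y') (z + z') := by
  refine (Tendsto.add h h').congr fun t => ?_
  rw [← smul_add, map_add]
  congr 1
  abel

theorem HasGeneratorValue.smul {S : ℝ → Y →L[ℂ] Y} {y z : Y} (c : ℂ)
    (h : HasGeneratorValue S y z) : HasGeneratorValue S (c • y) (c • z) := by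
  refine (Tendsto.const_smul h c).congr fun t => ?_
  rw [map_smul, smul_comm, smul_sub]

theorem HasGeneratorValue.unique {S : ℝ → Y →L[ℂ] Y} {y z z' : Y}
    (h : HasGeneratorValue S y z) (h' : HasGeneratorValue S y z') : z = z' :=
  tendsto_nhds_unique h h'

/-- The infinitesimal generator of the family `(S(t))_{t > 0}`, as an unbounded operator:
its domain consists of the `y` for which `lim_{t ↓ 0} (S(t) y - y) / t` exists, and its value at
such a `y` is that limit. -/
def generator (S : ℝ → Y →L[ℂ] Y) : Y →ₗ.[ℂ] Y where
  domain :=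
    { carrier := {y | ∃ z, HasGeneratorValue S y z}
      add_mem' := fun ⟨z, hz⟩ ⟨z', hz'⟩ => ⟨z + z', hz.add hz'⟩
      zero_mem' := ⟨0, by simp [HasGeneratorValue]⟩
      smul_mem' := fun c _ ⟨z, hz⟩ => ⟨c • z, hz.smul c⟩ }
  toFun :=
    { toFun := fun y => y.2.choose
      map_add' := fun y y' =>
        (y + y').2.choose_spec.unique (y.2.choose_spec.add y'.2.choose_spec)
      map_smul' := fun c y => (c • y).2.choose_spec.unique (y.2.choose_spec.smul c) }

/-- An operator is bounded if it is everywhere defined and bounded in norm. -/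
def IsBoundedOperator (B : Y →ₗ.[ℂ] Y) : Prop :=
  B.domain = ⊤ ∧ ∃ C : ℝ, ∀ y : B.domain, ‖B y‖ ≤ C * ‖(y : Y)‖

end Generator

/-! ### Analytic semigroups -/

/-- An analytic semigroup of bounded operators on `X`, defined on the sector `S_α`: a norm-analytic
map with `T(s + t) = T(s) T(t)`. No behaviour at the vertex `0` is prescribed. Only the values on
`S_α` are meaningful. -/
structure AnalyticSemigroup (α : ℝ) (X : Type*) [NormedAddCommGroup X] [NormedSpace ℂ X] where
  /-- The operator `T(t)`. -/
  op : ℂ → X →L[ℂ] X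
  op_add : ∀ s ∈ sector α, ∀ t ∈ sector α, op (s + t) = op s * op t
  analytic : DifferentiableOn ℂ op (sector α)

namespace AnalyticSemigroup

variable {α : ℝ} {X : Type*} [NormedAddCommGroup X] [NormedSpace ℂ X]

/-- `F(-uA) = ∫ T(uξ) dμ(ξ)`, where `F` is the Fourier–Borel transform of `μ` and `A` is the
generator of `T`. -/
def calculus (T : AnalyticSemigroup α X) (μ : ComplexMeasure ℂ) (u : ℂ) : X →L[ℂ] X :=
  cintegral μ fun ξ => T.op (u * ξ)

/-- `T` is quasinilpotent: every `T(t)` has spectral radius `0`. -/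
def IsQuasinilpotent (T : AnalyticSemigroup α X) : Prop :=
  ∀ t ∈ sector α, spectralRadius ℂ (T.op t) = 0

/-- `𝒜_T`: the closed (not necessarily unital) subalgebra of `B(X)` generated by the `T(t)`. -/
def algebra (T : AnalyticSemigroup α X) : NonUnitalSubalgebra ℂ (X →L[ℂ] X) :=
  (NonUnitalAlgebra.adjoin ℂ (T.op '' sector α)).topologicalClosure

theorem op_mem_algebra (T : AnalyticSemigroup α X) {t : ℂ} (ht : t ∈ sector α) :
    T.op t ∈ T.algebra :=
  NonUnitalSubalgebra.le_topologicalClosure _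
    (NonUnitalAlgebra.subset_adjoin ℂ (mem_image_of_mem _ ht))

theorem algebra_mul_comm (T : AnalyticSemigroup α X) (x y : T.algebra) : x * y = y * x := by
  have hgen : ∀ a ∈ T.op '' sector α, ∀ b ∈ T.op '' sector α, a * b = b * a := by
    rintro _ ⟨s, hs, rfl⟩ _ ⟨t, ht, rfl⟩
    rw [← T.op_add s hs t ht, ← T.op_add t ht s hs, add_comm]
  have hcomm := NonUnitalAlgebra.isMulCommutative_adjoin ℂ hgen
  let _ := NonUnitalSubalgebra.nonUnitalCommRingTopologicalClosure
    (NonUnitalAlgebra.adjoin ℂ (T.op '' sector α)) fun x y => hcomm.is_comm.comm x y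
  exact mul_comm (G := (NonUnitalAlgebra.adjoin ℂ (T.op '' sector α)).topologicalClosure) x y

instance (T : AnalyticSemigroup α X) : NonUnitalNormedCommRing T.algebra :=
  { (inferInstance : NonUnitalNormedRing T.algebra) with
    mul_comm := T.algebra_mul_comm }

instance (T : AnalyticSemigroup α X) : NormedSpace ℂ T.algebra :=
  inferInstanceAs (NormedSpace ℂ T.algebra.toSubmodule)

instance [CompleteSpace X] (T : AnalyticSemigroup α X) : CompleteSpace T.algebra :=
  (NonUnitalSubalgebra.isClosed_topologicalClosure _).completeSpace_coe

open Classical in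
/-- The element `T(t)` of `𝒜_T`, for `t ∈ S_α` (and `0` for other `t`). -/
def elem (T : AnalyticSemigroup α X) (t : ℂ) : T.algebra :=
  if ht : t ∈ sector α then ⟨T.op t, T.op_mem_algebra ht⟩ else 0

/-- `π(T(t))`, acting by multiplication on `𝒜_T / rad 𝒜_T`. -/
def quotientSemigroup [CompleteSpace X] (T : AnalyticSemigroup α X) (t : ℂ) :
    RadicalQuotient T.algebra →L[ℂ] RadicalQuotient T.algebra :=
  ContinuousLinearMap.mul ℂ (RadicalQuotient T.algebra) (toRadicalQuotient (T.elem t))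

end AnalyticSemigroup

end SectorialSemigroup

end

/-! The whole argument takes place on the Gelfand side. The characters of the unitization of `𝒜_T`
other than the augmentation are nonzero on `𝒜_T`, and the radical is the common kernel of all of
them (`mem_radical_iff`). For such a character `φ`, the function `t ↦ φ(T(t))` is holomorphic and
multiplicative on a sector, hence equal to `e^{-lt}` for some exponent `l`
(`exists_eq_exp_of_multiplicative`). Integrating against `μ` gives `φ(F(-uA)) = F(ul)`, so `|F(ul)|
≤ ρ(F(-uA))`.

The crux is that the exponents form a bounded set (`exists_norm_le_of_fourierBorel_lt`). Otherwise
there are exponents `l_n` with `|l_n| → ∞` and `arg l_n → ω`. Since `|φ(T(t))|` is bounded over all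
`φ` for each `t ∈ S_α`, `|ω| ≤ π/2 - α`. Every point of the rotated sector `e^{iω} S_{α-β}` has the
form `u l_n` with `u ∈ S_{α-β}` arbitrarily small, so there `|F|` is at most the supremum of the
spectral radii. By symmetry of `μ` the same bound holds on the conjugate sector. Since `|ω| + (α -
β) ≤ π/2 - β` and `F` is bounded on `S_{π/2-β}`, Phragmén–Lindelöf carries the bound to everything
between the two, in particular to `S_{α-β}`, against the hypothesis.

Once the exponents are bounded, the values `e^{-lr}` are all close to `1` for one small `r > 0`,
while the augmentation takes the value `0` at `T(r)`. A Cauchy integral of the resolvent around `1`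
then gives an element `e` of `𝒜_T` on which every character nonzero on `𝒜_T` is `1`: an identity
modulo the radical. Relative to it `T(1)` has an inverse `b`, so `π(T(t)) = π(b T(1 + t))`, which is
differentiable at `t = 0` because `T` is analytic at `1`. -/

noncomputable section

namespace SectorialSemigroup

/-! ### Characters of the `L¹` unitization -/

section Unitization

open WeakDual

variable {A : Type*} [NonUnitalNormedCommRing A] [NormedSpace ℂ A]
  [IsScalarTower ℂ A A] [SMulCommClass ℂ A A]

variable (A) in
/-- The unitization of a commutative Banach algebra, with the `L¹` norm. -/
abbrev L1Unitization : Type _ := WithLp 1 (Unitization ℂ A)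

instance : NormedCommRing (L1Unitization A) :=
  { (inferInstance : NormedRing (L1Unitization A)) with
    mul_comm := fun x y => congrArg (WithLp.toLp 1) (mul_comm (WithLp.ofLp x) (WithLp.ofLp y)) }

variable (A) in
/-- The inclusion of a commutative Banach algebra in its unitization. -/
def unitizationInr : A →L[ℂ] L1Unitization A :=
  LinearMap.mkContinuous
    { toFun := fun a => WithLp.toLp 1 (a : Unitization ℂ A)
      map_add' := fun a b => congrArg (WithLp.toLp 1) (Unitization.inr_add ℂ a b)
      map_smul' := fun c a => congrArg (WithLp.toLp 1) (Unitization.inr_smul ℂ c a) }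
    1 fun a => by rw [one_mul]; exact (WithLp.unitization_norm_inr a).le

theorem unitizationInr_mul (a b : A) :
    unitizationInr A (a * b) = unitizationInr A a * unitizationInr A b :=
  congrArg (WithLp.toLp 1) (Unitization.inr_mul ℂ a b)

theorem norm_unitizationInr (a : A) : ‖unitizationInr A a‖ = ‖a‖ :=
  WithLp.unitization_norm_inr a

variable (A) in
/-- The augmentation `c + a ↦ c`. -/
def augmentation : L1Unitization A →ₐ[ℂ] ℂ :=
  (Unitization.fstHom ℂ A).comp (WithLp.unitizationAlgEquiv ℂ : L1Unitization A ≃ₐ[ℂ] _).toAlgHom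

theorem augmentation_unitizationInr (a : A) : augmentation A (unitizationInr A a) = 0 := rfl

theorem exists_unitizationInr_eq {x : L1Unitization A} (hx : augmentation A x = 0) :
    ∃ a : A, unitizationInr A a = x := by
  refine ⟨(WithLp.ofLp x).snd, ?_⟩
  have hx' : (WithLp.ofLp x).fst = 0 := hx
  refine congrArg (WithLp.toLp 1) (Unitization.ext ?_ ?_)
  · rw [hx']; rfl
  · rfl

theorem exists_mul_unitizationInr (x : L1Unitization A) (a : A) :
    ∃ b : A, unitizationInr A b = x * unitizationInr A a :=
  exists_unitizationInr_eq (by rw [map_mul, augmentation_unitizationInr, mul_zero])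

theorem unitizationInr_injective : Function.Injective (unitizationInr A) := by
  intro a b h
  rw [← sub_eq_zero, ← norm_eq_zero, ← norm_unitizationInr, map_sub, h, sub_self, norm_zero]

/-- The augmentation, as an element of the character space. -/
def augmentationCharacter [CompleteSpace A] : characterSpace ℂ (L1Unitization A) :=
  CharacterSpace.equivAlgHom.symm (augmentation A)

/-- The kernel of a character on the algebra. -/
def characterKer (φ : characterSpace ℂ (L1Unitization A)) : Submodule ℂ A where
  carrier := {a | φ (unitizationInr A a) = 0}
  add_mem' := fun {a b} ha hb => by
    simp only [mem_ofPred_eq, map_add] at *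
    rw [ha, hb, add_zero]
  zero_mem' := by simp
  smul_mem' := fun c a ha => by
    simp only [mem_ofPred_eq, map_smul] at *
    rw [ha, smul_zero]

theorem mem_characterKer {φ : characterSpace ℂ (L1Unitization A)} {a : A} :
    a ∈ characterKer φ ↔ φ (unitizationInr A a) = 0 := Iff.rfl

theorem isMaximalModularIdeal_characterKer {φ : characterSpace ℂ (L1Unitization A)} {a : A}
    (ha : φ (unitizationInr A a) ≠ 0) : IsMaximalModularIdeal (characterKer φ) := by
  have hideal : IsAlgIdeal (characterKer φ) := fun b x hx => by
    rw [mem_characterKer] at *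
    rw [unitizationInr_mul, map_mul, hx, mul_zero]
  refine ⟨⟨hideal, (φ (unitizationInr A a))⁻¹ • a, fun x => ?_⟩, fun h => ?_, fun J _ hlt => ?_⟩
  · rw [mem_characterKer, map_sub, unitizationInr_mul, map_sub, map_mul, map_smul, map_smul,
      smul_eq_mul, inv_mul_cancel₀ ha, one_mul, sub_self]
  · exact ha (mem_characterKer.1 (h ▸ Submodule.mem_top))
  · obtain ⟨y, hyJ, hy⟩ := SetLike.exists_of_lt hlt
    rw [mem_characterKer] at hy
    refine Submodule.eq_top_iff'.2 fun x => ?_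
    have hx : x - (φ (unitizationInr A x) / φ (unitizationInr A y)) • y ∈ characterKer φ := by
      rw [mem_characterKer, map_sub, map_sub, map_smul, map_smul, smul_eq_mul,
        div_mul_cancel₀ _ hy, sub_self]
    simpa using J.add_mem (hlt.le hx) (J.smul_mem (φ (unitizationInr A x) / φ (unitizationInr A y)) hyJ)

variable [CompleteSpace A]

/-- The elements `x` of the unitization with `xA ⊆ I` form a proper ideal `J` containing `I` and `1
- e`, where `e` is an identity modulo `I`. A maximal ideal above `J` is the kernel of a character
with value `1` at `e`, so its trace on `A` is a proper ideal containing `I`, and maximality of `I`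
forces equality. -/
theorem exists_characterKer_eq {I : Submodule ℂ A} (hI : IsMaximalModularIdeal I) :
    ∃ φ : characterSpace ℂ (L1Unitization A), characterKer φ = I := by
  obtain ⟨⟨hid, e, he⟩, hne, hmax⟩ := hI
  let J : Ideal (L1Unitization A) :=
    { carrier := {x | ∀ a b : A, unitizationInr A b = x * unitizationInr A a → b ∈ I}
      add_mem' := by
        intro x y hx hy a b hb
        obtain ⟨b₁, h₁⟩ := exists_mul_unitizationInr x a
        obtain ⟨b₂, h₂⟩ := exists_mul_unitizationInr y a
        have : b = b₁ + b₂ := unitizationInr_injective (by rw [hb, map_add, h₁, h₂, add_mul])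
        rw [this]
        exact I.add_mem (hx a b₁ h₁) (hy a b₂ h₂)
      zero_mem' := by
        intro a b hb
        have : b = 0 := unitizationInr_injective (by rw [hb, zero_mul, map_zero])
        rw [this]
        exact I.zero_mem
      smul_mem' := by
        intro c x hx a b hb
        obtain ⟨d, hd⟩ := exists_mul_unitizationInr c a
        exact hx d b (by rw [hb, hd, smul_eq_mul]; ring) }
  have hJI : ∀ a ∈ I, unitizationInr A a ∈ J := by
    intro a ha c b hb
    rw [← unitizationInr_mul] at hb
    rw [unitizationInr_injective hb, mul_comm]
    exact hid c a ha
  have heJ : 1 - unitizationInr A e ∈ J := by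
    intro a b hb
    have : b = a - e * a := unitizationInr_injective (by
      rw [hb, map_sub, unitizationInr_mul, sub_mul, one_mul])
    rw [this]
    exact he a
  have hJ : J ≠ ⊤ := by
    intro h
    refine hne (Submodule.eq_top_iff'.2 fun a => ?_)
    have h1 : (1 : L1Unitization A) ∈ J := by rw [h]; trivial
    exact h1 a a (by rw [one_mul])
  obtain ⟨M, hM, hJM⟩ := J.exists_le_maximal hJ
  refine ⟨M.toCharacterSpace, ?_⟩
  set φ := M.toCharacterSpace
  have hφe : φ (unitizationInr A e) = 1 := by
    have := M.toCharacterSpace_apply_eq_zero_of_mem (hJM heJ)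
    rw [map_sub, map_one, sub_eq_zero] at this
    exact this.symm
  have hle : I ≤ characterKer φ := fun a ha =>
    M.toCharacterSpace_apply_eq_zero_of_mem (hJM (hJI a ha))
  have hφ := isMaximalModularIdeal_characterKer (φ := φ) (a := e) (by rw [hφe]; exact one_ne_zero)
  by_contra hneq
  exact hφ.2.1 (hmax _ hφ.1.1 (lt_of_le_of_ne hle (Ne.symm hneq)))

theorem mem_radical_iff {a : A} : a ∈ radical A ↔
    ∀ φ : characterSpace ℂ (L1Unitization A), φ (unitizationInr A a) = 0 := by
  rw [radical, Submodule.mem_sInf]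
  refine ⟨fun h φ => ?_, fun h I hI => ?_⟩
  · by_contra hφ
    exact hφ (mem_characterKer.1 (h _ (isMaximalModularIdeal_characterKer hφ)))
  · obtain ⟨φ, rfl⟩ := exists_characterKer_eq hI
    exact h φ

end Unitization

/-! ### Restriction of the characters to the algebra -/

section Restriction

open WeakDual

variable {A : Type*} [NonUnitalNormedCommRing A] [NormedSpace ℂ A]
  [IsScalarTower ℂ A A] [SMulCommClass ℂ A A]

/-- A character of the unitization, restricted to the algebra. -/
def evalCharacter (φ : characterSpace ℂ (L1Unitization A)) : A →L[ℂ] ℂ :=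
  (CharacterSpace.toCLM φ).comp (unitizationInr A)

theorem evalCharacter_apply (φ : characterSpace ℂ (L1Unitization A)) (a : A) :
    evalCharacter φ a = φ (unitizationInr A a) := rfl

theorem evalCharacter_mul (φ : characterSpace ℂ (L1Unitization A)) (a b : A) :
    evalCharacter φ (a * b) = evalCharacter φ a * evalCharacter φ b := by
  rw [evalCharacter_apply, unitizationInr_mul, map_mul]
  rfl

variable [CompleteSpace A]

theorem exists_norm_evalCharacter_le (a : A) :
    ∃ C : ℝ, ∀ φ : characterSpace ℂ (L1Unitization A), ‖evalCharacter φ a‖ ≤ C :=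
  ⟨‖unitizationInr A a‖ * ‖(1 : L1Unitization A)‖, fun φ =>
    AlgHom.norm_apply_le_self_mul_norm_one (CharacterSpace.equivAlgHom φ) _⟩

/-- The spectral radius may be computed in any Banach algebra that contains the algebra. -/
theorem spectralRadius_unitizationInr {B : Type*} [NormedRing B] [NormedAlgebra ℂ B]
    [CompleteSpace B] {j : A → B} (hmul : ∀ a b, j (a * b) = j a * j b) (hj : ∀ a, ‖j a‖ = ‖a‖)
    (a : A) : spectralRadius ℂ (unitizationInr A a) = spectralRadius ℂ (j a) := by
  -- Only positive powers of `a` lie in `A`; these have the same norm in both algebras, and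
  -- Gelfand's formula needs no others.
  have hpow : ∀ n : ℕ, ∃ b : A, unitizationInr A b = unitizationInr A a ^ (n + 1) ∧
      j b = j a ^ (n + 1) := by
    intro n
    induction n with
    | zero => exact ⟨a, by rw [zero_add, pow_one], by rw [zero_add, pow_one]⟩
    | succ n ih =>
      obtain ⟨b, hb1, hb2⟩ := ih
      exact ⟨b * a, by rw [unitizationInr_mul, hb1, ← pow_succ], by rw [hmul, hb2, ← pow_succ]⟩
  refine tendsto_nhds_unique
    ((spectrum.pow_nnnorm_pow_one_div_tendsto_nhds_spectralRadius _).congr' ?_)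
    (spectrum.pow_nnnorm_pow_one_div_tendsto_nhds_spectralRadius (j a))
  filter_upwards [eventually_ge_atTop 1] with n hn
  obtain ⟨m, rfl⟩ := Nat.exists_eq_add_of_le' hn
  obtain ⟨b, hb1, hb2⟩ := hpow m
  have : ‖unitizationInr A b‖₊ = ‖j b‖₊ :=
    NNReal.eq ((norm_unitizationInr b).trans (hj b).symm)
  rw [← hb1, ← hb2, this]

theorem enorm_evalCharacter_le (φ : characterSpace ℂ (L1Unitization A)) (a : A) :
    ‖evalCharacter φ a‖ₑ ≤ spectralRadius ℂ (unitizationInr A a) :=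
  le_iSup₂ (f := fun k (_ : k ∈ spectrum ℂ (unitizationInr A a)) => (‖k‖₊ : ℝ≥0∞)) _
    (CharacterSpace.mem_spectrum_iff_exists.2 ⟨φ, rfl⟩)

theorem exists_evalCharacter_ne_zero {a : A} (ha : spectralRadius ℂ (unitizationInr A a) ≠ 0) :
    ∃ φ : characterSpace ℂ (L1Unitization A), evalCharacter φ a ≠ 0 := by
  by_contra! hzero
  refine ha (le_antisymm (iSup₂_le fun k hk => ?_) zero_le)
  obtain ⟨φ, rfl⟩ := CharacterSpace.mem_spectrum_iff_exists.1 hk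
  rw [← evalCharacter_apply, hzero φ]
  simp

theorem toRadicalQuotient_eq_iff {a b : A} : toRadicalQuotient a = toRadicalQuotient b ↔
    ∀ φ : characterSpace ℂ (L1Unitization A), evalCharacter φ a = evalCharacter φ b := by
  unfold toRadicalQuotient
  rw [← sub_eq_zero, ← map_sub, Submodule.mkQ_apply, Submodule.Quotient.mk_eq_zero, mem_radical_iff]
  simp only [← evalCharacter_apply, map_sub, sub_eq_zero]

end Restriction

/-! ### The idempotent of an isolated part of the spectrum -/

section Idempotent

open WeakDual

theorem character_resolvent {U : Type*} [NormedCommRing U] [NormedAlgebra ℂ U]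
    (φ : characterSpace ℂ U) {x : U} {z : ℂ} (hz : z ∈ resolventSet ℂ x) :
    φ (resolvent x z) = (z - φ x)⁻¹ := by
  have h : (algebraMap ℂ U z - x) * resolvent x z = 1 := Ring.mul_inverse_cancel _ hz
  have h' := congrArg φ h
  rw [map_mul, map_sub, AlgHomClass.commutes, map_one] at h'
  exact eq_inv_of_mul_eq_one_right h'

/-- The Riesz projection for the part of the spectrum of `x` near `1`. Only its Gelfand transform is
needed, so idempotence is never proved: a character moves inside the integral and leaves the winding
number of the circle about `φ x`. -/
theorem exists_character_eq_ite {U : Type*} [NormedCommRing U] [NormedAlgebra ℂ U]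
    [CompleteSpace U] (x : U)
    (hx : ∀ φ : characterSpace ℂ U, φ x = 0 ∨ ‖φ x - 1‖ < 1 / 2) :
    ∃ p : U, ∀ φ : characterSpace ℂ U, (φ x = 0 → φ p = 0) ∧ (φ x ≠ 0 → φ p = 1) := by
  -- The spectrum consists of the values `φ x`, which are `0` or strictly inside the circle.
  have hres : ∀ z ∈ Metric.sphere (1 : ℂ) (1 / 2), z ∈ resolventSet ℂ x := by
    intro z hz
    by_contra hmem
    rw [mem_sphere_iff_norm] at hz
    obtain ⟨φ, rfl⟩ := CharacterSpace.mem_spectrum_iff_exists.1 hmem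
    rcases hx φ with h | h
    · rw [h] at hz; norm_num at hz
    · exact h.ne hz
  have hcont : ContinuousOn (resolvent x) (Metric.sphere (1 : ℂ) (1 / 2)) := fun z hz =>
    (spectrum.hasDerivAt_resolvent_const_left (hres z hz)).continuousAt.continuousWithinAt
  have hint : CircleIntegrable (resolvent x) 1 (1 / 2) := hcont.circleIntegrable (by norm_num)
  refine ⟨((2 * Real.pi * Complex.I : ℂ)⁻¹) • ∮ z in C(1, 1 / 2), resolvent x z, fun φ => ?_⟩
  have key : φ (∮ z in C(1, 1 / 2), resolvent x z) = ∮ z in C(1, 1 / 2), (z - φ x)⁻¹ := by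
    have h1 := (CharacterSpace.toCLM φ).intervalIntegral_comp_comm hint.out
    rw [circleIntegral, circleIntegral]
    refine Eq.trans h1.symm (intervalIntegral.integral_congr fun θ _ => ?_)
    have hmem : circleMap 1 (1 / 2) θ ∈ Metric.sphere (1 : ℂ) (1 / 2) :=
      circleMap_mem_sphere _ (by norm_num) _
    have h2 := character_resolvent φ (hres _ hmem)
    simp only [map_smul, CharacterSpace.coe_toCLM, h2]
  have hpi : (2 * Real.pi * Complex.I : ℂ) ≠ 0 := Complex.two_pi_I_ne_zero
  rw [map_smul, key]
  refine ⟨fun h0 => ?_, fun h0 => ?_⟩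
  · have : ∮ z in C(1, 1 / 2), (z - φ x)⁻¹ = 0 := by
      refine Complex.circleIntegral_eq_zero_of_differentiable_on_off_countable (by norm_num)
        countable_empty ?_ ?_
      all_goals
        rw [h0]
        simp only [sub_zero]
      · refine continuousOn_id.inv₀ ?_
        rintro z hz rfl
        rw [Metric.mem_closedBall, dist_eq_norm] at hz
        norm_num at hz
      · rintro z ⟨hz, -⟩
        refine differentiableAt_id.inv ?_
        rintro (rfl : z = 0)
        rw [Metric.mem_ball, dist_eq_norm] at hz
        norm_num at hz
    rw [this, smul_zero]
  · rw [circleIntegral.integral_sub_inv_of_mem_ball, smul_eq_mul, inv_mul_cancel₀ hpi]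
    rw [Metric.mem_ball, dist_eq_norm]
    exact (hx φ).resolve_left h0

variable {A : Type*} [NonUnitalNormedCommRing A] [NormedSpace ℂ A]
  [IsScalarTower ℂ A A] [SMulCommClass ℂ A A] [CompleteSpace A]

theorem exists_idempotent_mod_radical {a : A}
    (ha : ∀ φ : characterSpace ℂ (L1Unitization A), (∃ x, evalCharacter φ x ≠ 0) →
      evalCharacter φ a ≠ 0 ∧ ‖evalCharacter φ a - 1‖ < 1 / 2) :
    ∃ e : A, ∀ φ : characterSpace ℂ (L1Unitization A), (∃ x, evalCharacter φ x ≠ 0) →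
      evalCharacter φ e = 1 := by
  obtain ⟨p, hp⟩ := exists_character_eq_ite (unitizationInr A a) fun φ => by
    by_cases h : ∃ x, evalCharacter φ x ≠ 0
    · exact Or.inr (ha φ h).2
    · push Not at h
      exact Or.inl (h a)
  -- The augmentation kills `a`, hence kills `p`, and its kernel is exactly `A`.
  obtain ⟨e, rfl⟩ := exists_unitizationInr_eq ((hp augmentationCharacter).1
    (augmentation_unitizationInr a))
  exact ⟨e, fun φ hφ => (hp φ).2 (ha φ hφ).1⟩

theorem exists_inverse_mod_radical {e t : A}
    (he : ∀ φ : characterSpace ℂ (L1Unitization A), (∃ x, evalCharacter φ x ≠ 0) →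
      evalCharacter φ e = 1)
    (ht : ∀ φ : characterSpace ℂ (L1Unitization A), (∃ x, evalCharacter φ x ≠ 0) →
      evalCharacter φ t ≠ 0) :
    ∃ b : A, toRadicalQuotient (b * t) = toRadicalQuotient e := by
  -- A character nonzero on `A` takes the value `φ t ≠ 0` here, and one vanishing on `A` takes the
  -- value `1`. Multiplying the inverse by `e` brings it back into `A`.
  have hunit : IsUnit (unitizationInr A t + (1 - unitizationInr A e)) := by
    by_contra hnot
    obtain ⟨φ, hφ⟩ := CharacterSpace.exists_apply_eq_zero hnot
    rw [map_add, map_sub, map_one, ← evalCharacter_apply, ← evalCharacter_apply] at hφ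
    by_cases h : ∃ x, evalCharacter φ x ≠ 0
    · rw [he φ h, sub_self, add_zero] at hφ
      exact ht φ h hφ
    · push Not at h
      rw [h, h] at hφ
      norm_num at hφ
  obtain ⟨v, hv⟩ := hunit.exists_left_inv
  obtain ⟨b, hb⟩ := exists_mul_unitizationInr v e
  refine ⟨b, toRadicalQuotient_eq_iff.2 fun φ => ?_⟩
  by_cases h : ∃ x, evalCharacter φ x ≠ 0
  · have h1 := congrArg φ hv
    rw [map_mul, map_add, map_sub, map_one, ← evalCharacter_apply, ← evalCharacter_apply, he φ h,
      sub_self, add_zero] at h1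
    rw [evalCharacter_mul, evalCharacter_apply φ b, hb, map_mul, ← evalCharacter_apply, he φ h,
      mul_one, h1]
  · push Not at h
    rw [h, h]

theorem toRadicalQuotient_identity {e : A}
    (he : ∀ φ : characterSpace ℂ (L1Unitization A), (∃ x, evalCharacter φ x ≠ 0) →
      evalCharacter φ e = 1) (y : RadicalQuotient A) : toRadicalQuotient e * y = y := by
  obtain ⟨a, rfl⟩ := toRadicalQuotient_surjective y
  rw [← toRadicalQuotient_mul]
  refine toRadicalQuotient_eq_iff.2 fun φ => ?_
  rw [evalCharacter_mul]
  by_cases h : ∃ x, evalCharacter φ x ≠ 0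
  · rw [he φ h, one_mul]
  · push Not at h
    rw [h a, mul_zero]

end Idempotent

/-! ### Sectors and multiplicative functions on them -/

section Sector

/-- Without `arg`, openness, convexity and stability under addition follow from the triangle
inequality and continuity of the norm. -/
theorem mem_sector_iff_cos {γ : ℝ} (h0 : 0 < γ) (h1 : γ < Real.pi / 2) {z : ℂ} :
    z ∈ sector γ ↔ ‖z‖ * Real.cos γ < z.re := by
  have hcos : 0 < Real.cos γ := Real.cos_pos_of_mem_Ioo ⟨by linarith, h1⟩
  have hre := Complex.norm_mul_cos_arg z
  have key : ‖z‖ ≠ 0 → (|z.arg| < γ ↔ ‖z‖ * Real.cos γ < z.re) := fun hz => by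
    have hz' : 0 < ‖z‖ := lt_of_le_of_ne (norm_nonneg _) (Ne.symm hz)
    rw [← hre, mul_lt_mul_iff_right₀ hz', ← Real.cos_abs z.arg]
    exact (Real.strictAntiOn_cos.lt_iff_gt ⟨h0.le, by linarith⟩
      ⟨abs_nonneg _, Complex.abs_arg_le_pi z⟩).symm
  constructor
  · rintro ⟨hz, harg⟩
    refine (key fun h => ?_).1 harg
    rw [norm_eq_zero] at h
    rw [h] at hz
    exact lt_irrefl _ hz
  · intro h
    have hz : 0 < z.re := lt_of_le_of_lt (by positivity) h
    refine ⟨hz, (key fun h' => ?_).2 h⟩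
    rw [norm_eq_zero] at h'
    rw [h'] at hz
    exact lt_irrefl _ hz

theorem mem_sector_iff_arg {γ : ℝ} (h1 : γ ≤ Real.pi / 2) {z : ℂ} :
    z ∈ sector γ ↔ z ≠ 0 ∧ |z.arg| < γ := by
  constructor
  · rintro ⟨hz, h⟩
    refine ⟨?_, h⟩
    rintro rfl
    exact lt_irrefl _ hz
  · rintro ⟨hz, h⟩
    exact ⟨(Complex.abs_arg_lt_pi_div_two_iff.1 (h.trans_le h1)).resolve_right hz, h⟩

theorem isOpen_sector {γ : ℝ} (h0 : 0 < γ) (h1 : γ < Real.pi / 2) : IsOpen (sector γ) := by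
  have : sector γ = {z : ℂ | ‖z‖ * Real.cos γ < z.re} :=
    Set.ext fun z => mem_sector_iff_cos h0 h1
  rw [this]
  exact isOpen_lt (by fun_prop) Complex.continuous_re

theorem convex_sector {γ : ℝ} (h0 : 0 < γ) (h1 : γ < Real.pi / 2) : Convex ℝ (sector γ) := by
  have hcos : 0 < Real.cos γ := Real.cos_pos_of_mem_Ioo ⟨by linarith, h1⟩
  intro x hx y hy a b ha hb hab
  rw [mem_sector_iff_cos h0 h1] at *
  have hn : ‖a • x + b • y‖ ≤ a * ‖x‖ + b * ‖y‖ := by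
    refine (norm_add_le _ _).trans ?_
    rw [norm_smul, norm_smul, Real.norm_of_nonneg ha, Real.norm_of_nonneg hb]
  have hr : (a • x + b • y).re = a * x.re + b * y.re := by simp
  rw [hr]
  refine (mul_le_mul_of_nonneg_right hn hcos.le).trans_lt ?_
  rcases ha.eq_or_lt with rfl | ha'
  · have : b = 1 := by linarith
    rw [this]; linarith
  · have := mul_lt_mul_of_pos_left hx ha'
    have := mul_le_mul_of_nonneg_left hy.le hb
    linarith

theorem add_mem_sector {γ : ℝ} (h0 : 0 < γ) (h1 : γ < Real.pi / 2) {z w : ℂ}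
    (hz : z ∈ sector γ) (hw : w ∈ sector γ) : z + w ∈ sector γ := by
  have hcos : 0 < Real.cos γ := Real.cos_pos_of_mem_Ioo ⟨by linarith, h1⟩
  rw [mem_sector_iff_cos h0 h1] at *
  rw [Complex.add_re]
  have := mul_le_mul_of_nonneg_right (norm_add_le z w) hcos.le
  linarith

theorem ofReal_mem_sector {γ : ℝ} (h0 : 0 < γ) {t : ℝ} (ht : 0 < t) : (t : ℂ) ∈ sector γ :=
  ⟨by simpa using ht, by rw [Complex.arg_ofReal_of_nonneg ht.le, abs_zero]; exact h0⟩

theorem mul_mem_sector {γ δ : ℝ} (h : γ + δ ≤ Real.pi / 2) {z w : ℂ}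
    (hz : z ∈ sector γ) (hw : w ∈ sector δ) : z * w ∈ sector (γ + δ) := by
  have hz0 : z ≠ 0 := by rintro rfl; exact lt_irrefl _ hz.1
  have hw0 : w ≠ 0 := by rintro rfl; exact lt_irrefl _ hw.1
  have hz' := abs_lt.1 hz.2
  have hw' := abs_lt.1 hw.2
  have hpi := Real.pi_pos
  rw [mem_sector_iff_arg h]
  refine ⟨mul_ne_zero hz0 hw0, ?_⟩
  rw [Complex.arg_mul hz0 hw0 ⟨by linarith, by linarith⟩, abs_lt]
  constructor <;> linarith

theorem exists_eq_exp_of_multiplicative {α : ℝ} (h0 : 0 < α) (h1 : α < Real.pi / 2) {f : ℂ → ℂ}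
    (hd : DifferentiableOn ℂ f (sector α))
    (hmul : ∀ s ∈ sector α, ∀ t ∈ sector α, f (s + t) = f s * f t)
    (hne : ∃ t ∈ sector α, f t ≠ 0) :
    ∃ l : ℂ, ∀ t ∈ sector α, f t = Complex.exp (-(l * t)) := by
  have hop := isOpen_sector h0 h1
  have hpre := (convex_sector h0 h1).isPreconnected
  -- A zero at `t` makes `f` vanish on `t + S_α`, an open set, hence everywhere by the identity
  -- theorem.
  have hnz : ∀ t ∈ sector α, f t ≠ 0 := by
    intro t ht hft
    obtain ⟨s, hs, hfs⟩ := hne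
    have hts := add_mem_sector h0 h1 ht hs
    have hcont : Tendsto (fun z : ℂ => z - t) (𝓝 (t + s)) (𝓝 s) := by
      have : Continuous fun z : ℂ => z - t := by fun_prop
      simpa using this.tendsto (t + s)
    have hev : f =ᶠ[𝓝 (t + s)] 0 := by
      filter_upwards [hcont.eventually (hop.mem_nhds hs)] with z hz
      have := hmul t ht (z - t) hz
      rw [add_sub_cancel, hft, zero_mul] at this
      exact this
    exact hfs ((hd.analyticOnNhd hop).eqOn_zero_of_preconnected_of_eventuallyEq_zero hpre hts hev hs)
  have hda : ∀ t ∈ sector α, HasDerivAt f (deriv f t) t := fun t ht =>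
    (hd.differentiableAt (hop.mem_nhds ht)).hasDerivAt
  have hone := ofReal_mem_sector h0 one_pos
  -- Differentiating `f(s + t) = f(s) f(t)` at `s = 1` in either variable gives `f'(1) f(t) = f'(1 +
  -- t) = f(1) f'(t)`. The base point is `1` since nothing is known at `0`.
  have hderiv : ∀ t ∈ sector α, deriv f t = deriv f (1 : ℝ) / f (1 : ℝ) * f t := by
    intro t ht
    have e1 : HasDerivAt (fun s => f (s + t)) (deriv f (1 : ℝ) * f t) ((1 : ℝ) : ℂ) := by
      refine ((hda _ hone).mul_const (f t)).congr_of_eventuallyEq ?_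
      filter_upwards [hop.mem_nhds hone] with s hs
      exact hmul s hs t ht
    have e2 : HasDerivAt (fun s => f ((1 : ℝ) + s)) (f (1 : ℝ) * deriv f t) t := by
      refine ((hda _ ht).const_mul (f (1 : ℝ))).congr_of_eventuallyEq ?_
      filter_upwards [hop.mem_nhds ht] with s hs
      exact hmul _ hone s hs
    have e3 := hda _ (add_mem_sector h0 h1 hone ht)
    have e4 := e1.unique (HasDerivAt.comp_add_const _ _ e3)
    have e5 := e2.unique (HasDerivAt.comp_const_add _ _ e3)
    rw [div_mul_eq_mul_div, eq_div_iff (hnz _ hone), mul_comm (deriv f t), e5, ← e4]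
  set c := deriv f (1 : ℝ) / f (1 : ℝ) with hc
  have hexp : ∀ t : ℂ, HasDerivAt (fun t => Complex.exp (-(c * t))) (Complex.exp (-(c * t)) * -c) t :=
    fun t => by
      have := ((hasDerivAt_id t).const_mul c).neg.cexp
      simpa using this
  have hconst : ∀ t ∈ sector α, f t * Complex.exp (-(c * t)) =
      f (1 : ℝ) * Complex.exp (-(c * (1 : ℝ))) := by
    intro t ht
    refine hop.is_const_of_deriv_eq_zero hpre (f := fun t => f t * Complex.exp (-(c * t))) ?_ ?_ ht hone
    · exact fun z hz => ((hda z hz).mul (hexp z)).differentiableAt.differentiableWithinAt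
    · intro z hz
      refine ((hda z hz).mul (hexp z)).deriv.trans ?_
      rw [hderiv z hz, Pi.zero_apply]
      ring
  set k := f (1 : ℝ) * Complex.exp (-(c * (1 : ℝ))) with hk
  have hk0 : k ≠ 0 := mul_ne_zero (hnz _ hone) (Complex.exp_ne_zero _)
  have hfk : ∀ t ∈ sector α, f t = k * Complex.exp (c * t) := by
    intro t ht
    rw [← hconst t ht, mul_assoc, ← Complex.exp_add, neg_add_cancel, Complex.exp_zero, mul_one]
  -- With no value at `0` to normalize by, the constant comes from `f(1 + 1) = f(1)²`, that is, `k =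
  -- k²`.
  have hk1 : k = 1 := by
    have e := hmul _ hone _ hone
    rw [hfk _ (add_mem_sector h0 h1 hone hone), hfk _ hone, mul_add, Complex.exp_add] at e
    have hE := Complex.exp_ne_zero (c * (1 : ℝ))
    have e' : k * (Complex.exp (c * (1 : ℝ)) * Complex.exp (c * (1 : ℝ))) * (k - 1) = 0 := by
      linear_combination -e
    exact sub_eq_zero.1 ((mul_eq_zero.1 e').resolve_left (mul_ne_zero hk0 (mul_ne_zero hE hE)))
  refine ⟨-c, fun t ht => ?_⟩
  rw [hfk t ht, hk1, one_mul, neg_mul, neg_neg]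

end Sector

/-! ### Integration against complex measures -/

section Integral

variable {E E' : Type*} [NormedAddCommGroup E] [NormedSpace ℂ E] [CompleteSpace E]
  [NormedAddCommGroup E'] [NormedSpace ℂ E'] [CompleteSpace E']

instance isFiniteMeasure_variation (μ : ComplexMeasure ℂ) : IsFiniteMeasure μ.variation := by
  have h : μ.variation ≤
      (ComplexMeasure.re μ).totalVariation + (ComplexMeasure.im μ).totalVariation := by
    refine VectorMeasure.variation_le_of_forall_enorm_le fun s hs => ?_
    calc ‖μ s‖ₑ = ‖((μ s).re : ℂ) + (μ s).im * Complex.I‖ₑ := by rw [Complex.re_add_im]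
      _ ≤ ‖((μ s).re : ℂ)‖ₑ + ‖((μ s).im : ℂ) * Complex.I‖ₑ := enorm_add_le _ _
      _ = ‖(μ s).re‖ₑ + ‖(μ s).im‖ₑ := by
        rw [← ofReal_norm, ← ofReal_norm, norm_mul, Complex.norm_I, mul_one, Complex.norm_real,
          Complex.norm_real, ofReal_norm, ofReal_norm]
      _ ≤ _ := add_le_add (SignedMeasure.enorm_le_totalVariation (ComplexMeasure.re μ) s)
        (SignedMeasure.enorm_le_totalVariation (ComplexMeasure.im μ) s)
  exact isFiniteMeasure_of_le _ h

theorem cintegral_indicator_const (μ : ComplexMeasure ℂ) {s : Set ℂ} (hs : MeasurableSet s)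
    (c : E) : cintegral μ (s.indicator fun _ => c) = μ s • c := by
  unfold cintegral VectorMeasure.integral
  rw [setToFun_indicator_const _ hs (measure_ne_top _ _)]
  rfl

/-- Semilinear maps commute with the integral: `L (∫ f dμ) = ∫ L ∘ f dν` if `ν = σ ∘ μ` and `L` is
semilinear with respect to `σ`. -/
theorem map_cintegral_of_semilinear {μ ν : ComplexMeasure ℂ} (σ : ℂ → ℂ)
    (hσ : ∀ s, MeasurableSet s → ν s = σ (μ s)) (hνμ : ν.variation = μ.variation) (L : E →L[ℝ] E')
    (hL : ∀ (c : ℂ) (x : E), L (c • x) = σ c • L x) {f : ℂ → E} (hf : Integrable f μ.variation) :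
    L (cintegral μ f) = cintegral ν fun ξ => L (f ξ) := by
  refine Integrable.induction (μ := μ.variation)
    (fun f => L (cintegral μ f) = cintegral ν fun ξ => L (f ξ)) ?_ ?_ ?_ ?_ hf
  · intro c s hs _
    have : (fun ξ => L (s.indicator (fun _ => c) ξ)) = s.indicator fun _ => L c := by
      ext ξ
      by_cases h : ξ ∈ s <;> simp [h]
    rw [this, cintegral_indicator_const _ hs, cintegral_indicator_const _ hs, hL, hσ s hs]
  · intro f g _ hf hg h1 h2
    have hfg : (fun ξ => L ((f + g) ξ)) = fun ξ => L (f ξ) + L (g ξ) := by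
      ext ξ; simp
    have e1 : cintegral μ (f + g) = cintegral μ f + cintegral μ g :=
      VectorMeasure.integral_add hf hg
    have e2 : cintegral ν (fun ξ => L (f ξ) + L (g ξ)) =
        cintegral ν (fun ξ => L (f ξ)) + cintegral ν fun ξ => L (g ξ) :=
      VectorMeasure.integral_fun_add (μ := ν)
        (by rw [VectorMeasure.Integrable, hνμ]; exact L.integrable_comp hf)
        (by rw [VectorMeasure.Integrable, hνμ]; exact L.integrable_comp hg)
    rw [hfg, e1, e2, map_add, h1, h2]
  · refine isClosed_eq (L.continuous.comp VectorMeasure.continuous_integral) ?_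
    have hc : Continuous fun g : ℂ →₁[ν.variation] E' => cintegral ν g :=
      VectorMeasure.continuous_integral
    rw [hνμ] at hc
    refine (hc.comp (L.compLpL 1 μ.variation).continuous).congr fun g => ?_
    refine VectorMeasure.integral_congr_ae ?_
    rw [hνμ]
    exact L.coeFn_compLp g
  · intro f g hfg _ h
    have e1 : cintegral μ f = cintegral μ g := VectorMeasure.integral_congr_ae hfg
    have e2 : cintegral ν (fun ξ => L (f ξ)) = cintegral ν fun ξ => L (g ξ) := by
      refine VectorMeasure.integral_congr_ae ?_
      rw [hνμ]
      filter_upwards [hfg] with ξ hξ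
      rw [hξ]
    rw [← e1, ← e2, h]

theorem map_cintegral (μ : ComplexMeasure ℂ) (L : E →L[ℂ] E') {f : ℂ → E}
    (hf : Integrable f μ.variation) : L (cintegral μ f) = cintegral μ fun ξ => L (f ξ) :=
  map_cintegral_of_semilinear id (fun _ _ => rfl) rfl (L.restrictScalars ℝ)
    (fun c x => L.map_smul c x) hf

theorem norm_cintegral_le (μ : ComplexMeasure ℂ) :
    ∃ M : ℝ, 0 ≤ M ∧ ∀ (f : ℂ → ℂ) (C : ℝ), (∀ᵐ ξ ∂μ.variation, ‖f ξ‖ ≤ C) →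
      ‖cintegral μ f‖ ≤ C * M :=
  ⟨‖(ContinuousLinearMap.lsmul ℝ ℂ : ℂ →L[ℝ] ℂ →L[ℝ] ℂ).flip‖ * μ.variation.real univ,
    by positivity, fun f C h => by
      rw [← mul_assoc]
      exact VectorMeasure.norm_integral_le_of_norm_le_const h⟩

/-- Almost every point of a compactly supported measure is in a compact subset. -/
theorem IsCompactlySupportedIn.exists_ae {μ : ComplexMeasure ℂ} {S : Set ℂ}
    (h : IsCompactlySupportedIn μ S) :
    ∃ K : Set ℂ, IsCompact K ∧ K ⊆ S ∧ ∀ᵐ ξ ∂μ.variation, ξ ∈ K := by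
  obtain ⟨K, hK, hKS, h0⟩ := h
  exact ⟨K, hK, hKS, h0⟩

theorem integrable_of_continuousOn {E : Type*} [NormedAddCommGroup E] {μ : ComplexMeasure ℂ} {K : Set ℂ} (hK : IsCompact K)
    (hμ : ∀ᵐ ξ ∂μ.variation, ξ ∈ K) {f : ℂ → E} (hf : ContinuousOn f K) :
    Integrable f μ.variation := by
  have h : μ.variation.restrict K = μ.variation := Measure.restrict_eq_self_of_ae_mem hμ
  rw [← h]
  exact hf.integrableOn_compact hK

/-- Symmetry says that the image of `μ` under conjugation is the conjugate of `μ`. Conjugation is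
therefore semilinear from `μ`-integrals to integrals against the image measure, and a change of
variables returns to `μ`. -/
theorem cintegral_conj {μ : ComplexMeasure ℂ} (hμ : IsSymmetricMeasure μ) {f : ℂ → ℂ}
    (hf : Integrable f μ.variation) :
    starRingEnd ℂ (cintegral μ f) =
      cintegral μ fun ξ => starRingEnd ℂ (f (starRingEnd ℂ ξ)) := by
  let e : ℂ ≃ᵐ ℂ := Complex.conjCLE.toHomeomorph.toMeasurableEquiv
  have he : ∀ ξ, e ξ = starRingEnd ℂ ξ := fun _ => rfl
  have hpre : ∀ s : Set ℂ, e ⁻¹' s = starRingEnd ℂ '' s := by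
    intro s
    ext z
    constructor
    · exact fun h => ⟨starRingEnd ℂ z, h, Complex.conj_conj z⟩
    · rintro ⟨w, hw, rfl⟩
      change starRingEnd ℂ (starRingEnd ℂ w) ∈ s
      rwa [Complex.conj_conj]
  have hmap : ∀ s, MeasurableSet s → μ.map e s = starRingEnd ℂ (μ s) := by
    intro s hs
    rw [VectorMeasure.map_apply _ e.measurable hs, hpre, hμ s hs]
  have hvar : (μ.map e).variation = μ.variation := by
    have key : ∀ ν ν' : ComplexMeasure ℂ, (∀ s, MeasurableSet s → ν' s = starRingEnd ℂ (ν s)) →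
        ν'.variation ≤ ν.variation := by
      intro ν ν' hν
      refine VectorMeasure.variation_le_of_forall_enorm_le fun s hs => ?_
      rw [hν s hs, ← ofReal_norm, RCLike.norm_conj, ofReal_norm]
      exact VectorMeasure.enorm_measure_le_variation ν s
    refine le_antisymm (key _ _ hmap) (key _ _ fun s hs => ?_)
    rw [hmap s hs, Complex.conj_conj]
  have h1 := map_cintegral_of_semilinear (μ := μ) (ν := μ.map e) (starRingEnd ℂ) hmap hvar
    (Complex.conjCLE : ℂ →L[ℝ] ℂ) (fun c x => map_mul (starRingEnd ℂ) c x) hf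
  exact h1.trans (VectorMeasure.integral_map_equiv e _)

end Integral

/-! ### The Fourier–Borel transform on sectors -/

section FourierBorel

theorem integrable_exp {μ : ComplexMeasure ℂ} {K : Set ℂ} (hK : IsCompact K)
    (hμ : ∀ᵐ ξ ∂μ.variation, ξ ∈ K) (z : ℂ) :
    Integrable (fun ξ => Complex.exp (-(z * ξ))) μ.variation :=
  integrable_of_continuousOn hK hμ (by fun_prop)

theorem differentiable_fourierBorel {μ : ComplexMeasure ℂ} {S : Set ℂ}
    (h : IsCompactlySupportedIn μ S) : Differentiable ℂ (fourierBorel μ) := by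
  obtain ⟨K, hK, -, hμ⟩ := h.exists_ae
  obtain ⟨R, hR, hKR⟩ := hK.isBounded.exists_pos_norm_le
  obtain ⟨M, hM, hbound⟩ := norm_cintegral_le μ
  intro z
  suffices HasDerivAt (fourierBorel μ)
      (cintegral μ fun ξ => -(ξ * Complex.exp (-(z * ξ)))) z from this.differentiableAt
  rw [hasDerivAt_iff_isLittleO_nhds_zero]
  have hbig : (fun k => fourierBorel μ (z + k) - fourierBorel μ z -
      k • cintegral μ fun ξ => -(ξ * Complex.exp (-(z * ξ)))) =O[𝓝 0] fun k : ℂ => k ^ 2 := by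
    refine Asymptotics.IsBigO.of_bound (Real.exp (‖z‖ * R) * R ^ 2 * M) ?_
    -- This gives `|kξ| ≤ 1` on `K`, the range in which `|e^w - 1 - w| ≤ |w|²` is applied.
    have hsmall : ∀ᶠ k : ℂ in 𝓝 0, ‖k‖ < R⁻¹ := by
      filter_upwards [Metric.ball_mem_nhds (0 : ℂ) (inv_pos.2 hR)] with k hk
      simpa using hk
    filter_upwards [hsmall] with k hk
    have hi1 := integrable_exp hK hμ (z + k)
    have hi2 := integrable_exp hK hμ z
    have hi3 : Integrable (fun ξ => -(ξ * Complex.exp (-(z * ξ)))) μ.variation :=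
      integrable_of_continuousOn hK hμ (by fun_prop)
    have hi4 : Integrable (fun ξ => k * -(ξ * Complex.exp (-(z * ξ)))) μ.variation :=
      hi3.const_mul k
    have e3 : k • cintegral μ (fun ξ => -(ξ * Complex.exp (-(z * ξ)))) =
        cintegral μ fun ξ => k * -(ξ * Complex.exp (-(z * ξ))) :=
      map_cintegral μ (k • ContinuousLinearMap.id ℂ ℂ) hi3
    have e : fourierBorel μ (z + k) - fourierBorel μ z -
        k • cintegral μ (fun ξ => -(ξ * Complex.exp (-(z * ξ)))) =
        cintegral μ fun ξ => Complex.exp (-((z + k) * ξ)) - Complex.exp (-(z * ξ)) -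
          k * -(ξ * Complex.exp (-(z * ξ))) := by
      rw [e3]
      refine Eq.trans ?_ (VectorMeasure.integral_fun_sub (hi1.sub hi2) hi4).symm
      exact congrArg₂ _ (VectorMeasure.integral_fun_sub hi1 hi2).symm rfl
    rw [e]
    have hle : ∀ᵐ ξ ∂μ.variation, ‖Complex.exp (-((z + k) * ξ)) - Complex.exp (-(z * ξ)) -
        k * -(ξ * Complex.exp (-(z * ξ)))‖ ≤ Real.exp (‖z‖ * R) * (‖k‖ * R) ^ 2 := by
      filter_upwards [hμ] with ξ hξ
      have hξR := hKR ξ hξ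
      have hfac : Complex.exp (-((z + k) * ξ)) - Complex.exp (-(z * ξ)) -
          k * -(ξ * Complex.exp (-(z * ξ))) =
          Complex.exp (-(z * ξ)) * (Complex.exp (-(k * ξ)) - 1 - -(k * ξ)) := by
        rw [show -((z + k) * ξ) = -(z * ξ) + -(k * ξ) by ring, Complex.exp_add]
        ring
      have hkξ : ‖-(k * ξ)‖ ≤ ‖k‖ * R := by
        rw [norm_neg, norm_mul]
        gcongr
      have hk1 : ‖k‖ * R ≤ 1 := by
        have := mul_le_mul_of_nonneg_right hk.le hR.le
        rwa [inv_mul_cancel₀ hR.ne'] at this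
      rw [hfac, norm_mul]
      refine mul_le_mul ?_ ?_ (norm_nonneg _) (Real.exp_pos _).le
      · refine (Complex.norm_exp_le_exp_norm _).trans (Real.exp_le_exp.2 ?_)
        rw [norm_neg, norm_mul]
        gcongr
      · refine (Complex.norm_exp_sub_one_sub_id_le (hkξ.trans hk1)).trans ?_
        gcongr
    refine (hbound _ _ hle).trans (le_of_eq ?_)
    rw [norm_pow]
    ring
  exact hbig.trans_isLittleO (Asymptotics.isLittleO_pow_id one_lt_two)

theorem fourierBorel_conj {μ : ComplexMeasure ℂ} {S : Set ℂ} (h : IsCompactlySupportedIn μ S)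
    (hμ : IsSymmetricMeasure μ) (z : ℂ) :
    fourierBorel μ (starRingEnd ℂ z) = starRingEnd ℂ (fourierBorel μ z) := by
  obtain ⟨K, hK, -, hae⟩ := h.exists_ae
  unfold fourierBorel
  rw [cintegral_conj hμ (integrable_exp hK hae z)]
  congr 1
  ext ξ
  rw [← Complex.exp_conj, map_neg, map_mul, Complex.conj_conj]

/-! ### Logarithmic coordinates and the Phragmén–Lindelöf principle: sectors become horizontal
strips. -/

theorem exp_mem_sector {γ : ℝ} (hγ : γ ≤ Real.pi / 2) {w : ℂ} (hw : |w.im| < γ) :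
    Complex.exp w ∈ sector γ := by
  have hpi := Real.pi_pos
  have hw' := abs_lt.1 hw
  rw [mem_sector_iff_arg hγ, Complex.arg_exp, (toIocMod_eq_self _).2 ⟨by linarith, by linarith⟩]
  exact ⟨Complex.exp_ne_zero _, hw⟩

/-- For `z ∈ S_{π/2-β}` and `ξ ∈ S_β` the product `zξ` lies in the right half-plane, so the
integrand has modulus at most `1`. -/
theorem exists_norm_fourierBorel_exp_le {μ : ComplexMeasure ℂ} {β : ℝ}
    (h : IsCompactlySupportedIn μ (sector β)) :
    ∃ M : ℝ, ∀ w : ℂ, |w.im| < Real.pi / 2 - β → ‖fourierBorel μ (Complex.exp w)‖ ≤ M := by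
  obtain ⟨K, hK, hKS, hμ⟩ := h.exists_ae
  obtain ⟨M, hM, hbound⟩ := norm_cintegral_le μ
  refine ⟨1 * M, fun w hw => hbound _ _ ?_⟩
  filter_upwards [hμ] with ξ hξ
  have hβ : 0 ≤ β := (abs_nonneg _).trans (hKS hξ).2.le
  have hmem := mul_mem_sector (by linarith) (exp_mem_sector (by linarith) hw) (hKS hξ)
  rw [Complex.norm_exp, Real.exp_le_one_iff, Complex.neg_re, neg_nonpos]
  exact hmem.1.le

theorem norm_fourierBorel_exp_le_of_boundary {μ : ComplexMeasure ℂ} {β : ℝ}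
    (h : IsCompactlySupportedIn μ (sector β)) {δ C : ℝ} (h0 : 0 < δ) (hδ : δ < Real.pi / 2 - β)
    (hC : ∀ w : ℂ, |w.im| = δ → ‖fourierBorel μ (Complex.exp w)‖ ≤ C) {w : ℂ} (hw : |w.im| ≤ δ) :
    ‖fourierBorel μ (Complex.exp w)‖ ≤ C := by
  obtain ⟨M, hM⟩ := exists_norm_fourierBorel_exp_le h
  have hw' := abs_le.1 hw
  refine PhragmenLindelof.horizontal_strip (a := -δ) (b := δ)
    (f := fun w => fourierBorel μ (Complex.exp w)) ?_ ?_ ?_ ?_ hw'.1 hw'.2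
  · exact ((differentiable_fourierBorel h).comp Complex.differentiable_exp).diffContOnCl
  -- The function is bounded on the strip, so the growth condition holds with both exponential
  -- constants zero.
  · refine ⟨0, div_pos Real.pi_pos (by linarith), 0, ?_⟩
    refine Asymptotics.IsBigO.of_bound M ?_
    refine Filter.mem_inf_of_right (mem_principal.2 fun w hw => ?_)
    have : |w.im| < Real.pi / 2 - β := (abs_lt.2 hw).trans hδ
    simpa using hM w this
  · intro w hw
    exact hC w (by rw [hw, abs_neg, abs_of_pos h0])
  · intro w hw
    exact hC w (by rw [hw, abs_of_pos h0])

/-- A bound for the Fourier–Borel transform of a symmetric measure on a rotated sector holds on the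
sector. -/
theorem norm_fourierBorel_le_of_rotated_sector {μ : ComplexMeasure ℂ} {β γ ω C : ℝ}
    (h : IsCompactlySupportedIn μ (sector β)) (hsymm : IsSymmetricMeasure μ)
    (hω : |ω| + γ ≤ Real.pi / 2 - β)
    (hC : ∀ w : ℂ, |w.im - ω| < γ → ‖fourierBorel μ (Complex.exp w)‖ ≤ C) {z : ℂ}
    (hz : z ∈ sector γ) : ‖fourierBorel μ z‖ ≤ C := by
  have hz0 : z ≠ 0 := by rintro rfl; exact lt_irrefl _ hz.1
  have hconj : ∀ w, ‖fourierBorel μ (Complex.exp (starRingEnd ℂ w))‖ =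
      ‖fourierBorel μ (Complex.exp w)‖ := fun w => by
    rw [Complex.exp_conj, fourierBorel_conj h hsymm, RCLike.norm_conj]
  obtain ⟨γ', h1, h2⟩ := exists_between hz.2
  have hγ' : 0 < γ' := (abs_nonneg _).trans_lt h1
  have hω0 := abs_nonneg ω
  rw [← Complex.exp_log hz0]
  -- With `|arg z| < γ' < γ`, one of the lines `Im w = ±(|ω| + γ')` lies in the strip where the
  -- bound is assumed, and the other is its conjugate.
  refine norm_fourierBorel_exp_le_of_boundary h (δ := |ω| + γ') (by linarith) (by linarith) ?_
    (by rw [Complex.log_im]; linarith)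
  have hhalf : ∀ w : ℂ, w.im = |ω| + γ' → ‖fourierBorel μ (Complex.exp w)‖ ≤ C := by
    intro w hw
    rcases abs_cases ω with ⟨he, -⟩ | ⟨he, -⟩
    · refine hC w ?_
      rw [hw, he, add_sub_cancel_left, abs_of_pos hγ']
      exact h2
    · rw [← hconj]
      refine hC _ ?_
      rw [Complex.conj_im, hw, he, show -(-ω + γ') - ω = -γ' by ring, abs_neg, abs_of_pos hγ']
      exact h2
  intro w hw
  rcases eq_or_eq_neg_of_abs_eq hw with h' | h'
  · exact hhalf w h'
  · rw [← hconj]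
    exact hhalf _ (by rw [Complex.conj_im, h', neg_neg])

theorem abs_le_of_cos_add_nonneg {α ω : ℝ} (h0 : 0 < α) (h1 : α < Real.pi / 2)
    (hω : |ω| ≤ Real.pi) (h : ∀ θ, |θ| < α → 0 ≤ Real.cos (ω + θ)) : |ω| ≤ Real.pi / 2 - α := by
  have key : ∀ ω : ℝ, ω ≤ Real.pi → (∀ θ, |θ| < α → 0 ≤ Real.cos (ω + θ)) →
      ω ≤ Real.pi / 2 - α := by
    intro ω hω h
    by_contra! hlt
    rcases le_or_gt ω (Real.pi / 2) with hle | hgt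
    -- An admissible rotation takes `ω` just past `π/2`, where the cosine is negative.
    · obtain ⟨θ, h2, h3⟩ := exists_between (show Real.pi / 2 - ω < α by linarith)
      have := h θ (by rw [abs_of_nonneg (by linarith)]; exact h3)
      exact absurd this (not_le.2
        (Real.cos_neg_of_pi_div_two_lt_of_lt (by linarith) (by linarith)))
    · have := h 0 (by rwa [abs_zero])
      rw [add_zero] at this
      exact absurd this (not_le.2
        (Real.cos_neg_of_pi_div_two_lt_of_lt hgt (by linarith)))
  rcases abs_cases ω with ⟨he, -⟩ | ⟨he, -⟩
  · rw [he] at hω ⊢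
    exact key ω hω h
  · rw [he] at hω ⊢
    refine key _ hω fun θ hθ => ?_
    rw [← Real.cos_neg, show -(-ω + θ) = ω + -θ by ring]
    exact h _ (by rwa [abs_neg])

/-- A set of exponents is bounded if the exponentials are bounded pointwise on the sector and the
Fourier–Borel transform does not reach its supremum near the vertex along the set. -/
theorem exists_norm_le_of_fourierBorel_lt {α β : ℝ} (hβ : 0 < β) (hβα : β < α)
    (hα : α < Real.pi / 2) {μ : ComplexMeasure ℂ} (hsupp : IsCompactlySupportedIn μ (sector β))
    (hsymm : IsSymmetricMeasure μ) {Λ : Set ℂ}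
    (hΛ : ∀ t ∈ sector α, ∃ C : ℝ, ∀ l ∈ Λ, ‖Complex.exp (-(l * t))‖ ≤ C) {t₀ C : ℝ} (ht₀ : 0 < t₀)
    (hC : ∀ l ∈ Λ, ∀ u ∈ sector (α - β), ‖u‖ ≤ t₀ → ‖fourierBorel μ (u * l)‖ ≤ C) {z₀ : ℂ}
    (hz₀ : z₀ ∈ sector (α - β)) (hlt : C < ‖fourierBorel μ z₀‖) : ∃ R : ℝ, ∀ l ∈ Λ, ‖l‖ ≤ R := by
  by_contra! hunb
  have hα0 : 0 < α := hβ.trans hβα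
  choose l hlΛ hl using fun n : ℕ => hunb n
  have hl0 : ∀ n, l n ≠ 0 := fun n h => by
    have := hl n
    rw [h, norm_zero] at this
    exact absurd (Nat.cast_nonneg n) (not_le.2 this)
  obtain ⟨ω, hωmem, ψ, hψ, hlim⟩ := (isCompact_Icc (a := -Real.pi) (b := Real.pi)).tendsto_subseq
    (x := fun n => (l n).arg) fun n => abs_le.1 (Complex.abs_arg_le_pi _)
  have hnorm : Tendsto (fun n => ‖l (ψ n)‖) atTop atTop := by
    refine tendsto_atTop_mono (fun n => (hl (ψ n)).le) ?_
    exact tendsto_natCast_atTop_atTop.comp hψ.tendsto_atTop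
  have hω : |ω| ≤ Real.pi / 2 - α := by
    refine abs_le_of_cos_add_nonneg hα0 hα (abs_le.2 hωmem) fun θ hθ => ?_
    have hmem : Complex.exp (θ * Complex.I) ∈ sector α := exp_mem_sector hα.le (by simpa using hθ)
    obtain ⟨D, hD⟩ := hΛ _ hmem
    -- The bound `|e^{-lt}| ≤ D` at `t = e^{iθ}` reads `|l| cos(arg l + θ) ≥ -log D`; after division
    -- by `|l| → ∞` the right side disappears in the limit.
    have hcos : ∀ n, -(Real.log D / ‖l (ψ n)‖) ≤ Real.cos ((l (ψ n)).arg + θ) := by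
      intro n
      have h1 := hD _ (hlΛ (ψ n))
      have hpos := norm_pos_iff.2 (hl0 (ψ n))
      have hre : (l (ψ n) * Complex.exp (θ * Complex.I)).re =
          ‖l (ψ n)‖ * Real.cos ((l (ψ n)).arg + θ) := by
        conv_lhs => rw [← Complex.norm_mul_exp_arg_mul_I (l (ψ n))]
        rw [mul_assoc, ← Complex.exp_add, ← add_mul, ← Complex.ofReal_add, Complex.re_ofReal_mul,
          Complex.exp_ofReal_mul_I_re]
      rw [Complex.norm_exp, Complex.neg_re, hre] at h1
      have h2 := (Real.le_log_iff_exp_le ((Real.exp_pos _).trans_le h1)).2 h1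
      rw [neg_le, le_div_iff₀ hpos]
      linarith
    have hl1 : Tendsto (fun n => -(Real.log D / ‖l (ψ n)‖)) atTop (𝓝 0) := by
      have := (hnorm.const_div_atTop (Real.log D)).neg
      rwa [neg_zero] at this
    have hl2 : Tendsto (fun n => Real.cos ((l (ψ n)).arg + θ)) atTop (𝓝 (Real.cos (ω + θ))) :=
      (Real.continuous_cos.tendsto _).comp (hlim.add_const θ)
    exact le_of_tendsto_of_tendsto' hl1 hl2 hcos
  refine absurd hlt (not_lt.2 ?_)
  refine norm_fourierBorel_le_of_rotated_sector hsupp hsymm (ω := ω) (by linarith) ?_ hz₀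
  intro w hw
  have hangle : ∀ᶠ n in atTop, |w.im - (l (ψ n)).arg| < α - β := by
    have : Tendsto (fun n => |w.im - (l (ψ n)).arg|) atTop (𝓝 |w.im - ω|) :=
      (hlim.const_sub w.im).abs
    exact this.eventually (gt_mem_nhds hw)
  have hsmall : ∀ᶠ n in atTop, ‖Complex.exp w‖ / ‖l (ψ n)‖ < t₀ :=
    (hnorm.const_div_atTop _).eventually (gt_mem_nhds ht₀)
  obtain ⟨n, hn1, hn2⟩ := (hangle.and hsmall).exists
  -- The point `u = e^w / l_n` satisfies `u l_n = e^w`. For large `n` it is short because `|l_n| →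
  -- ∞`, and it lies in `S_{α-β}` because `arg l_n` is close to `ω`.
  have hu : Complex.exp (w - Complex.log (l (ψ n))) = Complex.exp w / l (ψ n) := by
    rw [Complex.exp_sub, Complex.exp_log (hl0 _)]
  have := hC _ (hlΛ (ψ n)) (Complex.exp w / l (ψ n))
    (by
      rw [← hu]
      exact exp_mem_sector (by linarith) (by rwa [Complex.sub_im, Complex.log_im]))
    (by rw [norm_div]; exact hn2.le)
  rwa [div_mul_cancel₀ _ (hl0 _)] at this

end FourierBorel

/-! ### Characters of the algebra of an analytic semigroup -/

namespace AnalyticSemigroup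

open WeakDual

variable {α : ℝ} {X : Type*} [NormedAddCommGroup X] [NormedSpace ℂ X]

theorem elem_of_mem (T : AnalyticSemigroup α X) {t : ℂ} (ht : t ∈ sector α) :
    T.elem t = ⟨T.op t, T.op_mem_algebra ht⟩ := dif_pos ht

theorem coe_elem (T : AnalyticSemigroup α X) {t : ℂ} (ht : t ∈ sector α) :
    (T.elem t : X →L[ℂ] X) = T.op t := by rw [T.elem_of_mem ht]

theorem elem_add (T : AnalyticSemigroup α X) (h0 : 0 < α) (h1 : α < Real.pi / 2) {s t : ℂ}
    (hs : s ∈ sector α) (ht : t ∈ sector α) : T.elem (s + t) = T.elem s * T.elem t := by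
  refine Subtype.ext ?_
  rw [T.coe_elem (add_mem_sector h0 h1 hs ht), T.op_add s hs t ht, ← T.coe_elem hs,
    ← T.coe_elem ht]
  rfl

/-- The inclusion of `𝒜_T` in `B(X)`. -/
def algebraInclusion (T : AnalyticSemigroup α X) : T.algebra →L[ℂ] X →L[ℂ] X :=
  LinearMap.mkContinuous
    { toFun := Subtype.val
      map_add' := fun _ _ => rfl
      map_smul' := fun _ _ => rfl } 1 fun a => by rw [one_mul]; rfl

theorem isClosed_algebra (T : AnalyticSemigroup α X) : IsClosed (T.algebra : Set (X →L[ℂ] X)) :=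
  NonUnitalSubalgebra.isClosed_topologicalClosure _

/-- Difference quotients lie in `𝒜_T`, which is closed, so the derivative taken in `B(X)` does too.
-/
theorem exists_hasDerivAt_elem (T : AnalyticSemigroup α X) (h0 : 0 < α) (h1 : α < Real.pi / 2)
    {t : ℂ} (ht : t ∈ sector α) : ∃ D : T.algebra, HasDerivAt T.elem D t := by
  have hop := (isOpen_sector h0 h1).mem_nhds ht
  have hd := (T.analytic.differentiableAt hop).hasDerivAt
  rw [hasDerivAt_iff_tendsto_slope] at hd
  have hev : ∀ᶠ z in 𝓝[≠] t, slope T.op t z = (slope T.elem t z : X →L[ℂ] X) := by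
    filter_upwards [mem_nhdsWithin_of_mem_nhds hop] with z hz
    have : ((slope T.elem t z : T.algebra) : X →L[ℂ] X) =
        (z - t)⁻¹ • ((T.elem z : X →L[ℂ] X) - T.elem t) := rfl
    rw [this, T.coe_elem hz, T.coe_elem ht]
    rfl
  have hD : deriv T.op t ∈ T.algebra :=
    T.isClosed_algebra.mem_of_tendsto (hd.congr' hev) (Eventually.of_forall fun z => Subtype.prop _)
  refine ⟨⟨_, hD⟩, hasDerivAt_iff_tendsto_slope.2 ?_⟩
  rw [tendsto_subtype_rng]
  exact hd.congr' hev

theorem continuousOn_elem (T : AnalyticSemigroup α X) (h0 : 0 < α) (h1 : α < Real.pi / 2) :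
    ContinuousOn T.elem (sector α) := fun _ ht =>
  (T.exists_hasDerivAt_elem h0 h1 ht).choose_spec.continuousAt.continuousWithinAt

/-- A character that vanishes on the semigroup vanishes on `𝒜_T`. -/
theorem exists_character_elem_ne_zero (T : AnalyticSemigroup α X) [CompleteSpace X]
    {φ : characterSpace ℂ (L1Unitization T.algebra)}
    (hφ : ∃ x, evalCharacter φ x ≠ 0) :
    ∃ t ∈ sector α, evalCharacter φ (T.elem t) ≠ 0 := by
  by_contra! hzero
  let K : NonUnitalSubalgebra ℂ (X →L[ℂ] X) :=
    { carrier := Subtype.val '' {x : T.algebra | evalCharacter φ x = 0}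
      add_mem' := by
        rintro _ _ ⟨x, hx, rfl⟩ ⟨y, hy, rfl⟩
        refine ⟨x + y, ?_, rfl⟩
        rw [mem_ofPred_eq] at *
        rw [map_add, hx, hy, add_zero]
      zero_mem' := ⟨0, map_zero (evalCharacter φ), rfl⟩
      mul_mem' := by
        rintro _ _ ⟨x, hx, rfl⟩ ⟨y, hy, rfl⟩
        refine ⟨x * y, ?_, rfl⟩
        rw [mem_ofPred_eq] at *
        rw [evalCharacter_mul, hx, zero_mul]
      smul_mem' := by
        rintro c _ ⟨x, hx, rfl⟩
        refine ⟨c • x, ?_, rfl⟩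
        rw [mem_ofPred_eq] at *
        rw [map_smul, hx, smul_zero] }
  have hclosed : IsClosed (K : Set (X →L[ℂ] X)) := by
    have hcl : IsClosed {x : T.algebra | evalCharacter φ x = 0} :=
      isClosed_eq (evalCharacter φ).continuous continuous_const
    exact T.isClosed_algebra.isClosedEmbedding_subtypeVal.isClosedMap _ hcl
  have hle : T.algebra ≤ K := by
    refine NonUnitalSubalgebra.topologicalClosure_minimal (NonUnitalAlgebra.adjoin_le ?_) hclosed
    rintro _ ⟨t, ht, rfl⟩
    exact ⟨T.elem t, hzero t ht, T.coe_elem ht⟩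
  obtain ⟨x, hx⟩ := hφ
  obtain ⟨y, hy0, hy⟩ := hle x.2
  exact hx ((Subtype.ext hy : y = x) ▸ hy0)

/-- The exponents of the characters: `φ(T(t)) = e^{-lt}`. -/
def exponents (T : AnalyticSemigroup α X) : Set ℂ :=
  {l | ∃ φ : characterSpace ℂ (L1Unitization T.algebra), ∀ t ∈ sector α,
    evalCharacter φ (T.elem t) = Complex.exp (-(l * t))}

theorem exists_character_exponent (T : AnalyticSemigroup α X) [CompleteSpace X] (h0 : 0 < α)
    (h1 : α < Real.pi / 2) {φ : characterSpace ℂ (L1Unitization T.algebra)}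
    (hφ : ∃ x, evalCharacter φ x ≠ 0) :
    ∃ l : ℂ, ∀ t ∈ sector α,
      evalCharacter φ (T.elem t) = Complex.exp (-(l * t)) := by
  refine exists_eq_exp_of_multiplicative h0 h1
    (f := fun t => evalCharacter φ (T.elem t)) ?_ ?_
    (T.exists_character_elem_ne_zero hφ)
  · intro t ht
    obtain ⟨D, hD⟩ := T.exists_hasDerivAt_elem h0 h1 ht
    have := (evalCharacter φ).hasFDerivAt.comp_hasDerivAt t hD
    exact this.differentiableAt.differentiableWithinAt
  · intro s hs t ht
    rw [T.elem_add h0 h1 hs ht, evalCharacter_mul]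

theorem spectralRadius_coe (T : AnalyticSemigroup α X) [CompleteSpace X] (a : T.algebra) :
    spectralRadius ℂ (unitizationInr T.algebra a) = spectralRadius ℂ (a : X →L[ℂ] X) :=
  spectralRadius_unitizationInr (j := Subtype.val) (fun _ _ => rfl) (fun _ => rfl) a

/-- `F(-uA)` belongs to `𝒜_T`, and a character with exponent `l` maps it to `F(ul)`. -/
theorem exists_coe_eq_calculus (T : AnalyticSemigroup α X) [CompleteSpace X] {β : ℝ} (hβ : 0 < β)
    (hβα : β < α) (hα : α < Real.pi / 2) {μ : ComplexMeasure ℂ}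
    (hμ : IsCompactlySupportedIn μ (sector β)) {u : ℂ} (hu : u ∈ sector (α - β)) :
    ∃ G : T.algebra, (G : X →L[ℂ] X) = T.calculus μ u ∧
      ∀ (φ : characterSpace ℂ (L1Unitization T.algebra)) (l : ℂ),
        (∀ t ∈ sector α, evalCharacter φ (T.elem t) = Complex.exp (-(l * t))) →
        evalCharacter φ G = fourierBorel μ (u * l) := by
  obtain ⟨K, hK, hKS, hae⟩ := hμ.exists_ae
  have hmem : ∀ ξ ∈ K, u * ξ ∈ sector α := fun ξ hξ => by
    have := mul_mem_sector (by linarith) hu (hKS hξ)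
    rwa [sub_add_cancel] at this
  have hcont : ContinuousOn (fun ξ => T.elem (u * ξ)) K :=
    (T.continuousOn_elem (hβ.trans hβα) hα).comp (by fun_prop) hmem
  have hint := integrable_of_continuousOn hK hae hcont
  -- Integrating in the Banach space `𝒜_T` itself makes membership automatic; the inclusion and the
  -- characters are bounded linear maps, hence pass under the integral.
  refine ⟨cintegral μ fun ξ => T.elem (u * ξ), ?_, fun φ l hφ => ?_⟩
  · refine (map_cintegral μ T.algebraInclusion hint).trans (VectorMeasure.integral_congr_ae ?_)
    filter_upwards [hae] with ξ hξ
    exact T.coe_elem (hmem ξ hξ)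
  · refine (map_cintegral μ (evalCharacter φ) hint).trans (VectorMeasure.integral_congr_ae ?_)
    filter_upwards [hae] with ξ hξ
    refine (hφ _ (hmem ξ hξ)).trans ?_
    congr 1
    ring

theorem exists_norm_exp_le (T : AnalyticSemigroup α X) [CompleteSpace X] {t : ℂ}
    (ht : t ∈ sector α) : ∃ C : ℝ, ∀ l ∈ T.exponents, ‖Complex.exp (-(l * t))‖ ≤ C := by
  obtain ⟨C, hC⟩ := exists_norm_evalCharacter_le (T.elem t)
  refine ⟨C, ?_⟩
  rintro l ⟨φ, hφ⟩
  rw [← hφ t ht]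
  exact hC φ

/-- The generator of the quotient semigroup is bounded if some `π(T(t))` is invertible. -/
theorem isBoundedOperator_generator (T : AnalyticSemigroup α X) [CompleteSpace X] (h0 : 0 < α)
    (h1 : α < Real.pi / 2) {b : T.algebra} {t₀ : ℂ} (ht₀ : t₀ ∈ sector α)
    (hb : ∀ y : RadicalQuotient T.algebra, toRadicalQuotient (b * T.elem t₀) * y = y) :
    IsBoundedOperator (generator fun t : ℝ => T.quotientSemigroup (t : ℂ)) := by
  obtain ⟨D, hD⟩ := T.exists_hasDerivAt_elem h0 h1 ht₀
  have hcont : Continuous (toRadicalQuotient : T.algebra → RadicalQuotient T.algebra) :=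
    continuous_quot_mk
  -- Since `π(T(t)) = π(b T(t₀ + t))`, the limit at the vertex becomes a derivative at the interior
  -- point `t₀`, and the generator is multiplication by `π(b T'(t₀))`.
  have hval : ∀ y : RadicalQuotient T.algebra, HasGeneratorValue
      (fun t : ℝ => T.quotientSemigroup (t : ℂ)) y (toRadicalQuotient (b * D) * y) := by
    intro y
    have hreal : Tendsto (fun t : ℝ => (t : ℂ)) (𝓝[>] 0) (𝓝[≠] 0) := by
      refine tendsto_nhdsWithin_iff.2 ⟨?_, ?_⟩
      · have := Complex.continuous_ofReal.tendsto 0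
        rw [Complex.ofReal_zero] at this
        exact this.mono_left nhdsWithin_le_nhds
      · filter_upwards [self_mem_nhdsWithin] with t ht
        exact Complex.ofReal_ne_zero.2 (ne_of_gt ht)
    have hslope := (hasDerivAt_iff_tendsto_slope_zero.1 hD).comp hreal
    have hmul : Continuous fun a : T.algebra => toRadicalQuotient (b * a) * y :=
      (hcont.comp (continuous_const_mul b)).mul continuous_const
    refine ((hmul.tendsto D).comp hslope).congr' ?_
    filter_upwards [self_mem_nhdsWithin] with t ht
    have hmem : (t : ℂ) ∈ sector α := ofReal_mem_sector h0 ht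
    have hq : T.quotientSemigroup (t : ℂ) y = toRadicalQuotient (T.elem t) * y := rfl
    have e1 : toRadicalQuotient (b * T.elem (t₀ + t)) * y = toRadicalQuotient (T.elem t) * y := by
      rw [T.elem_add h0 h1 ht₀ hmem, ← mul_assoc, toRadicalQuotient_mul, mul_assoc, hb]
    simp only [Function.comp_apply]
    rw [hq, mul_smul_comm, map_smul, mul_sub, map_sub, smul_mul_assoc, sub_mul, e1, hb]
  refine ⟨Submodule.eq_top_iff'.2 fun y => ⟨_, hval y⟩, ‖toRadicalQuotient (b * D)‖, fun y => ?_⟩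
  have : generator (fun t : ℝ => T.quotientSemigroup (t : ℂ)) y =
      toRadicalQuotient (b * D) * (y : RadicalQuotient T.algebra) :=
    HasGeneratorValue.unique y.2.choose_spec (hval y)
  rw [this]
  exact norm_mul_le _ _

/-- If the exponents are bounded, the quotient by the radical is unital and the generator of the
quotient semigroup is bounded. -/
theorem isUnital_and_isBoundedOperator (T : AnalyticSemigroup α X) [CompleteSpace X] (h0 : 0 < α)
    (h1 : α < Real.pi / 2) (hT : ¬ T.IsQuasinilpotent) {R : ℝ}
    (hR : ∀ l ∈ T.exponents, ‖l‖ ≤ R) : IsUnital (RadicalQuotient T.algebra) ∧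
      IsBoundedOperator (generator fun t : ℝ => T.quotientSemigroup (t : ℂ)) := by
  have hne : ∀ φ : characterSpace ℂ (L1Unitization T.algebra),
      (∃ x, evalCharacter φ x ≠ 0) → ∀ t ∈ sector α,
        evalCharacter φ (T.elem t) ≠ 0 := by
    intro φ hφ t ht
    obtain ⟨l, hl⟩ := T.exists_character_exponent h0 h1 hφ
    rw [hl t ht]
    exact Complex.exp_ne_zero _
  obtain ⟨e, he⟩ : ∃ e : T.algebra, ∀ φ : characterSpace ℂ (L1Unitization T.algebra),
      (∃ x, evalCharacter φ x ≠ 0) → evalCharacter φ e = 1 := by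
    -- Then `|lr| ≤ 1/8` for every exponent, and `|e^{-lr} - 1| ≤ 2|lr| < 1/2`, as the contour
    -- around `1` requires.
    set r : ℝ := (8 * (|R| + 1))⁻¹ with hr
    have hr0 : 0 < r := by positivity
    have hmem := ofReal_mem_sector h0 hr0
    refine exists_idempotent_mod_radical (a := T.elem (r : ℂ)) fun φ hφ => ⟨hne φ hφ _ hmem, ?_⟩
    obtain ⟨l, hl⟩ := T.exists_character_exponent h0 h1 hφ
    have hlR := hR l ⟨φ, hl⟩
    have hlr : ‖-(l * (r : ℂ))‖ ≤ 1 / 8 := by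
      rw [norm_neg, norm_mul, Complex.norm_real, Real.norm_of_nonneg hr0.le]
      calc ‖l‖ * r ≤ (|R| + 1) * r := by
            gcongr
            linarith [le_abs_self R]
        _ = 1 / 8 := by rw [hr]; field_simp
    rw [hl _ hmem]
    refine (Complex.norm_exp_sub_one_le (by linarith)).trans_lt ?_
    linarith
  have hone : ((1 : ℝ) : ℂ) ∈ sector α := ofReal_mem_sector h0 one_pos
  obtain ⟨b, hb⟩ := exists_inverse_mod_radical he fun φ hφ => hne φ hφ _ hone
  refine ⟨⟨toRadicalQuotient e, fun hzero => hT fun t ht => ?_, fun y =>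
    ⟨toRadicalQuotient_identity he y, ?_⟩⟩,
    T.isBoundedOperator_generator h0 h1 (b := b) hone fun y => ?_⟩
  -- A nonzero spectral radius yields a character nonzero on `𝒜_T`, and that character takes the
  -- value `1` at `e`, so `e` is not in the radical.
  · by_contra hrad
    rw [← T.coe_elem ht, ← T.spectralRadius_coe] at hrad
    obtain ⟨φ, hφ⟩ := exists_evalCharacter_ne_zero hrad
    have := toRadicalQuotient_eq_iff.1 (hzero.trans (map_zero toRadicalQuotient).symm) φ
    rw [he φ ⟨_, hφ⟩, map_zero] at this
    exact one_ne_zero this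
  · rw [mul_comm]
    exact toRadicalQuotient_identity he y
  · rw [hb]
    exact toRadicalQuotient_identity he y

end AnalyticSemigroup

end SectorialSemigroup
end

/-! ### The theorem: from spectral radii to bounded exponents. -/

open SectorialSemigroup in
theorem mainTheorem1 {X : Type*} [NormedAddCommGroup X] [NormedSpace ℂ X] [CompleteSpace X]
    (α β : ℝ) (hβ : 0 < β) (hβα : β < α) (hα : α < Real.pi / 2)
    (μ : ComplexMeasure ℂ) (hsupp : IsCompactlySupportedIn μ (sector β))
    (hsymm : IsSymmetricMeasure μ) (hmass : μ Set.univ = 0)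
    (T : AnalyticSemigroup α X) (hT : ¬ T.IsQuasinilpotent)
    (h : ∃ t₀ : ℝ, 0 < t₀ ∧
      (⨆ t ∈ {t : ℂ | t ∈ sector (α - β) ∧ ‖t‖ ≤ t₀}, spectralRadius ℂ (T.calculus μ t)) <
        ⨆ z ∈ sector (α - β), ‖fourierBorel μ z‖ₑ) :
    IsUnital (RadicalQuotient T.algebra) ∧
      IsBoundedOperator (generator fun t : ℝ => T.quotientSemigroup (t : ℂ)) := by
  obtain ⟨t₀, ht₀, hlt⟩ := h
  obtain ⟨z₀, hz₀⟩ := lt_iSup_iff.1 hlt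
  obtain ⟨hz₀mem, hz₀lt⟩ := lt_iSup_iff.1 hz₀
  set s := ⨆ t ∈ {t : ℂ | t ∈ sector (α - β) ∧ ‖t‖ ≤ t₀}, spectralRadius ℂ (T.calculus μ t)
  -- Strict inequality below the value of `|F|` at the single point `z₀` makes `s` finite, so the
  -- comparison can be carried out in the reals.
  have hs : s ≠ ⊤ := hz₀lt.ne_top
  have hle : ∀ l ∈ T.exponents, ∀ u ∈ sector (α - β), ‖u‖ ≤ t₀ →
      ‖fourierBorel μ (u * l)‖ ≤ s.toReal := by
    rintro l ⟨φ, hφ⟩ u hu hut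
    obtain ⟨G, hG, hGφ⟩ := T.exists_coe_eq_calculus hβ hβα hα hsupp hu
    rw [← hGφ φ l hφ, ← toReal_enorm]
    refine ENNReal.toReal_mono hs ((enorm_evalCharacter_le φ G).trans ?_)
    rw [T.spectralRadius_coe, hG]
    exact le_iSup₂ (f := fun t (_ : t ∈ {t : ℂ | t ∈ sector (α - β) ∧ ‖t‖ ≤ t₀}) =>
      spectralRadius ℂ (T.calculus μ t)) u ⟨hu, hut⟩
  have hlt' : s.toReal < ‖fourierBorel μ z₀‖ := by
    rw [← toReal_enorm]
    exact (ENNReal.toReal_lt_toReal hs enorm_ne_top).2 hz₀lt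
  obtain ⟨R, hR⟩ := exists_norm_le_of_fourierBorel_lt hβ hβα hα hsupp hsymm
    (fun t ht => T.exists_norm_exp_le ht) ht₀ hle hz₀mem hlt'
  exact T.isUnital_and_isBoundedOperator (hβ.trans hβα) hα hT hR
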